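/- **Setting.** Let $M\simeq\mathbb{Z}^n$ be a lattice of rank $n\ge 0$, $M_{\mathbb R}=M\otimes\mathbb R$ and $N_{\mathbb R}$ the dual space of $M_{\mathbb R}$. A *convex piecewise affine* function on a polytope $\Lambda\subset M_{\mathbb R}$ is a convex function $\psi:\Lambda\to\mathbb R$ that is affine on each of finitely many convex polyhedra whose union is $\Lambda$; its *cells* are the sets of the form $\{x\in\Lambda\mid \langle v,x\rangle+\psi(x)\le\langle v,y\rangle+\psi(y)\text{ for all }y\in\Lambda\}$ with $v\in N_{\mathbb R}$, and they form a subdivision $S(\psi)$ of $\Lambda$. For a family $\psi_0,\dots,\psi_n$ of such functions on polytopes $\Lambda_0,\dots,\Lambda_n$, the inf-convolution $\psi=\boxplus_i\psi_i$ is the function $\psi(x)=\inf\{\sum_i\psi_i(x_i)\mid x_i\in\Lambda_i,\ \sum_i x_i=x\}$ on $\Lambda=\sum_i\Lambda_i$. The *mixed subdivision* of $\Lambda$ is $S(\psi)$, considered together with the *components* $C_i$ of its cells $C$: here $C_i$ is the set of all $x_i$ for $(x_0,\dots,x_n)\in\prod_j\Lambda_j$ with $\sum_j x_j\in C$ and $\psi(\sum_jx_j)=\sum_j\psi_j(x_j)$.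 It is *tight* if $\sum_i\dim C_i=n$ for each $n$-cell $C$. For two families on the same polytopes, $S(\phi)\preceq S(\psi)$ means that for each $C\in S(\psi)$ there is $D\in S(\phi)$ with $C\subset D$ and $C_i\subset D_i$ for all $i$. The set of $n$-cells of $S(\phi)$ is denoted by $S(\phi)^n$. **Canny-Emiris matrices.** Let $\mathcal A=(\mathcal A_0,\dots,\mathcal A_n)$ be nonempty finite subsets of $M$, $\Delta_i=\operatorname{conv}(\mathcal A_i)$ and $\Delta=\sum_i\Delta_i$. Let $u=(u_{i,a})_{0\le i\le n,\,a\in\mathcal A_i}$ be variables and $F_i=\sum_{a\in\mathcal A_i}u_{i,a}\chi^a$, where $\chi^a$ denotes the monomial of $a\in M$ in the group algebra of $M$. Let $\rho=(\rho_0,\dots,\rho_n)$, where $\rho_i:\Delta_i\to\mathbb R$ is the function parametrizing the lower envelope of the convex hull of $\{(a,\nu_{i,a})\}_{a\in\mathcal A_i}\subset M_{\mathbb R}\times\mathbb R$ for some $\nu_i\in\mathbb R^{\mathcal A_i}$. Write $S(\rho)$ for the mixed subdivision of $\Delta$ induced by $\boxplus_i\rho_i$ and assume that it is tight. Let $\delta\in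 M_{\mathbb R}$ be such that $C+\delta$ contains no point of $M$ for each cell $C$ of $S(\rho)$ of dimension less than $n$. Set $\mathcal B=(\Delta+\delta)\cap M$, a finite set. Each $b\in\mathcal B$ lies in $C+\delta$ for a unique $n$-cell $C$ of $S(\rho)$; let $i(b)$ be the largest index $i$ with $\dim C_i=0$, and let $a(b)\in\mathcal A_{i(b)}$ be the point with $C_{i(b)}=\{a(b)\}$. The Canny-Emiris matrix $\mathcal H_{\mathcal A,\rho}$ is the $\mathcal B\times\mathcal B$ matrix whose $(b,b')$-entry is the coefficient of $\chi^{b'}$ in $\chi^{b-a(b)}F_{i(b)}$. For $\mathcal C\subset\mathcal B$ let $H_{\mathcal A,\rho,\mathcal C}\in\mathbb Z[u]$ denote the principal minor of this matrix with rows and columns in $\mathcal C$ (equal to $1$ if $\mathcal C=\emptyset$). For $\omega=(\omega_{i,a})_{i,a}$ with real entries and $P\in\mathbb C[u]$, the order $\operatorname{ord}_\omega(P)$ is the smallest exponent of $t$ in $P((t^{\omega_{i,a}}u_{i,a})_{i,a})$, and the initial part $\operatorname{init}_\omega(P)\in\mathbb C[u]$ is the corresponding coefficient; $\operatorname{ord}_\omega(0)=+\infty$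 and $\operatorname{init}_\omega(0)=0$. **Theorem.** Let $\phi_i:\Delta_i\to\mathbb R$, $i=0,\dots,n$, be convex piecewise affine functions such that the mixed subdivision $S(\phi)$ of $\Delta$ induced by $\phi=\boxplus_i\phi_i$ satisfies $S(\phi)\preceq S(\rho)$. For $D\in S(\phi)^n$ set $\mathcal A_D=(\mathcal A_i\cap D_i)_i$ and $\rho_D=(\rho_i|_{D_i})_i$, and let $\mathcal C_D=\mathcal C\cap(D+\delta)$ for $\mathcal C\subset\mathcal B$; the matrix $\mathcal H_{\mathcal A_D,\rho_D}$ and its principal minors $H_{\mathcal A_D,\rho_D,\mathcal C_D}$ are constructed as above from $\mathcal A_D$, $\rho_D$ (with the polytopes $D_i$) and the same $\delta$. Set $\omega=(\phi_i(a))_{i,a}$. Then for each $\mathcal C\subset\mathcal B$ $$\operatorname{ord}_\omega(H_{\mathcal A,\rho,\mathcal C})=\sum_{b\in\mathcal C}\phi_{i(b)}(a(b))\quad\text{and}\quad \operatorname{init}_\omega(H_{\mathcal A,\rho,\mathcal C})=\prod_{D\in S(\phi)^n}H_{\mathcal A_D,\rho_D,\mathcal C_D}.$$ In particular, $\operatorname{init}_\omega(\det\mathcal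 H_{\mathcal A,\rho})=\prod_{D\in S(\phi)^n}\det\mathcal H_{\mathcal A_D,\rho_D}$. -/

import Mathlib

open scoped Pointwise TensorProduct

noncomputable section

namespace CannyEmiris

/-! ### Polyhedral geometry -/

section Polyhedral

variable {V : Type*} [AddCommGroup V] [Module ℝ V]

/-- Convex polyhedra: intersections of finitely many closed halfspaces. -/
def IsPolyhedron (P : Set V) : Prop :=
  ∃ s : Finset (V →ᵃ[ℝ] ℝ), P = {x | ∀ g ∈ s, 0 ≤ g x}

/-- `ψ` is a convex piecewise affine function on `Λ`: it is convex on `Λ`, and `Λ` is a finite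
union of convex polyhedra on each of which `ψ` is affine. -/
def IsConvexPiecewiseAffineOn (Λ : Set V) (ψ : V → ℝ) : Prop :=
  ConvexOn ℝ Λ ψ ∧
    ∃ (k : ℕ) (P : Fin k → Set V), (∀ j, IsPolyhedron (P j)) ∧ Λ = ⋃ j, P j ∧
      ∀ j, ∃ l : V →ᵃ[ℝ] ℝ, Set.EqOn ψ l (P j)

/-- The dimension of (the affine span of) a nonempty set. -/
def dim (C : Set V) : ℕ := Module.finrank ℝ (vectorSpan ℝ C)

/-- The face of `K` in the direction `v`: the points of `K` where `v` attains its infimum. -/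
def face (K : Set V) (v : Module.Dual ℝ V) : Set V := {x ∈ K | ∀ y ∈ K, v x ≤ v y}

/-- The epigraph of a function `ψ` on `Λ`. -/
def epi (Λ : Set V) (ψ : V → ℝ) : Set (V × ℝ) := {p | p.1 ∈ Λ ∧ ψ p.1 ≤ p.2}

/-- The cell `C(ψ, v)`: the projection of the face of the epigraph in the direction `(v, 1)`. -/
def cell (Λ : Set V) (ψ : V → ℝ) (v : Module.Dual ℝ V) : Set V :=
  Prod.fst '' face (epi Λ ψ) (v.coprod LinearMap.id)

/-- The set of cells of the subdivision `S(ψ)` of `Λ`. -/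
def cells (Λ : Set V) (ψ : V → ℝ) : Set (Set V) := Set.range (cell Λ ψ)

section Mixed

variable {ι : Type*} [Fintype ι]

/-- The inf-convolution of a family of functions `ψ i` on `Λ i`, a function on `∑ i, Λ i`. -/
def infConv (Λ : ι → Set V) (ψ : ι → V → ℝ) (x : V) : ℝ :=
  sInf {z | ∃ y : ι → V, (∀ i, y i ∈ Λ i) ∧ ∑ i, y i = x ∧ ∑ i, ψ i (y i) = z}

/-- The cells of the mixed subdivision of `∑ i, Λ i` induced by a family of functions. -/
def mixedCells (Λ : ι → Set V) (ψ : ι → V → ℝ) : Set (Set V) :=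
  cells (∑ i, Λ i) (infConv Λ ψ)

/-- The cells of dimension `d` of the mixed subdivision. -/
def mixedCellsOfDim (Λ : ι → Set V) (ψ : ι → V → ℝ) (d : ℕ) : Set (Set V) :=
  {C ∈ mixedCells Λ ψ | dim C = d}

/-- The `i`-th component of a cell `C` of a mixed subdivision. -/
def component (Λ : ι → Set V) (ψ : ι → V → ℝ) (C : Set V) (i : ι) : Set V :=
  (fun x : ι → V => x i) ''
    {x | (∀ j, x j ∈ Λ j) ∧ ∑ j, x j ∈ C ∧ infConv Λ ψ (∑ j, x j) = ∑ j, ψ j (x j)}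

/-- A mixed subdivision in dimension `n` is tight if the dimensions of the components of each
`n`-cell add up to `n`. -/
def IsTight (Λ : ι → Set V) (ψ : ι → V → ℝ) (n : ℕ) : Prop :=
  ∀ C ∈ mixedCellsOfDim Λ ψ n, ∑ i, dim (component Λ ψ C i) = n

/-- `S(φ) ⪯ S(ψ)`: the mixed subdivision induced by `ψ` refines the one induced by `φ`. -/
def IsCoarser (Λ : ι → Set V) (φ ψ : ι → V → ℝ) : Prop :=
  ∀ C ∈ mixedCells Λ ψ, ∃ D ∈ mixedCells Λ φ,
    C ⊆ D ∧ ∀ i, component Λ ψ C i ⊆ component Λ φ D i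

end Mixed

end Polyhedral

/-! ### Orders and initial parts -/

section Order

variable {σ : Type*}

/-- The element `P((t ^ ω_s u_s)_s)` of `ℂ[u][t^ℝ]`. -/
def weighted (ω : σ → ℝ) (P : MvPolynomial σ ℂ) : AddMonoidAlgebra (MvPolynomial σ ℂ) ℝ :=
  MvPolynomial.aeval (fun s => AddMonoidAlgebra.single (ω s) (MvPolynomial.X s)) P

/-- The `ω`-order of a polynomial: the smallest exponent of `t` in `weighted ω P`,
which is `⊤` when `P = 0`. -/
def ord (ω : σ → ℝ) (P : MvPolynomial σ ℂ) : WithTop ℝ := (weighted ω P).coeff.support.min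

/-- The `ω`-initial part of a polynomial: the coefficient of the smallest power of `t` in
`weighted ω P`, which is `0` when `P = 0`. -/
def init (ω : σ → ℝ) (P : MvPolynomial σ ℂ) : MvPolynomial σ ℂ :=
  (weighted ω P).coeff ((ord ω P).untopD 0)

end Order

/-! ### Canny-Emiris matrices -/

section Matrices

variable {M : Type*} [AddCommGroup M]

/-- The inclusion of a lattice `M` in the real vector space `M_ℝ`. -/
def emb (M : Type*) [AddCommGroup M] : M →ₗ[ℤ] ℝ ⊗[ℤ] M := TensorProduct.mk ℤ ℝ M 1

/-- The convex hull in `M_ℝ` of a finite set of lattice points. -/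
def newton (A : Finset M) : Set (ℝ ⊗[ℤ] M) := convexHull ℝ (emb M '' (A : Set M))

/-- The function on `newton A` parametrizing the lower envelope of the convex hull of the lifted
points `(a, ν a)`, `a ∈ A`. -/
def lowerEnvelope (A : Finset M) (ν : M → ℝ) (x : ℝ ⊗[ℤ] M) : ℝ :=
  sInf {z | (x, z) ∈ convexHull ℝ ((fun a => (emb M a, ν a)) '' (A : Set M))}

variable {n : ℕ}

/-- The general Laurent polynomial with support `A i`, with variables `u_{i,a}`. -/
def laurent (A : Fin (n + 1) → Finset M) (i : Fin (n + 1)) :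
    AddMonoidAlgebra (MvPolynomial (Fin (n + 1) × M) ℂ) M :=
  ∑ a ∈ A i, AddMonoidAlgebra.single a (MvPolynomial.X (i, a))

/-- The map `(G_0, …, G_n) ↦ ∑ G_i F_i`. -/
def sylvester (A : Fin (n + 1) → Finset M)
    (G : Fin (n + 1) → AddMonoidAlgebra (MvPolynomial (Fin (n + 1) × M) ℂ) M) :
    AddMonoidAlgebra (MvPolynomial (Fin (n + 1) × M) ℂ) M :=
  ∑ i, G i * laurent A i

/-- The vector `δ` is generic: no lattice point lies in the translate by `δ` of a cell of
dimension less than `n`. -/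
def IsGeneric (Λ : Fin (n + 1) → Set (ℝ ⊗[ℤ] M)) (ρ : Fin (n + 1) → ℝ ⊗[ℤ] M → ℝ)
    (δ : ℝ ⊗[ℤ] M) : Prop :=
  ∀ C ∈ mixedCells Λ ρ, dim C < n → ∀ b : M, emb M b - δ ∉ C

/-- The index set: the lattice points of the translated polytope `∑ i, Λ i + δ`. -/
def indexSet (Λ : Fin (n + 1) → Set (ℝ ⊗[ℤ] M)) (δ : ℝ ⊗[ℤ] M) : Set M :=
  {b | emb M b - δ ∈ ∑ i, Λ i}

/-- `(i, a)` is the row content of `b`: the point `b` lies in the translate of an `n`-cell `C`,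
`i` is the largest index such that the component `C_i` is a point, and `a ∈ A i` is that point. -/
def IsRowContent (A : Fin (n + 1) → Finset M) (Λ : Fin (n + 1) → Set (ℝ ⊗[ℤ] M))
    (ρ : Fin (n + 1) → ℝ ⊗[ℤ] M → ℝ) (δ : ℝ ⊗[ℤ] M) (b : M) (p : Fin (n + 1) × M) : Prop :=
  ∃ C ∈ mixedCellsOfDim Λ ρ n, emb M b - δ ∈ C ∧
    IsGreatest {i | dim (component Λ ρ C i) = 0} p.1 ∧
    p.2 ∈ A p.1 ∧ component Λ ρ C p.1 = {emb M p.2}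

open Classical in
/-- The row content function `b ↦ (i(b), a(b))`, with value `(0, 0)` at the points without
row content. -/
def rowContent (A : Fin (n + 1) → Finset M) (Λ : Fin (n + 1) → Set (ℝ ⊗[ℤ] M))
    (ρ : Fin (n + 1) → ℝ ⊗[ℤ] M → ℝ) (δ : ℝ ⊗[ℤ] M) (b : M) : Fin (n + 1) × M :=
  if h : ∃ p, IsRowContent A Λ ρ δ b p then h.choose else (0, 0)

/-- The Canny-Emiris matrix. The row of `b` is the image under the Sylvester map of the basis
vector with entry `χ^(b - a(b))` in position `i(b)`, in terms of the monomials `χ^b'`. -/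
def matrix (A : Fin (n + 1) → Finset M) (Λ : Fin (n + 1) → Set (ℝ ⊗[ℤ] M))
    (ρ : Fin (n + 1) → ℝ ⊗[ℤ] M → ℝ) (δ : ℝ ⊗[ℤ] M) :
    Matrix M M (MvPolynomial (Fin (n + 1) × M) ℂ) :=
  fun b b' => (sylvester A (Pi.single (rowContent A Λ ρ δ b).1
    (AddMonoidAlgebra.single (b - (rowContent A Λ ρ δ b).2) 1))).coeff b'

open Classical in
/-- The principal minor of the Canny-Emiris matrix given by a finite set of indexes. -/
def minor (A : Fin (n + 1) → Finset M) (Λ : Fin (n + 1) → Set (ℝ ⊗[ℤ] M))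
    (ρ : Fin (n + 1) → ℝ ⊗[ℤ] M → ℝ) (δ : ℝ ⊗[ℤ] M) (C : Finset M) :
    MvPolynomial (Fin (n + 1) × M) ℂ :=
  ((matrix A Λ ρ δ).submatrix (fun b : C => (b : M)) (fun b : C => (b : M))).det

open Classical in
/-- The Canny-Emiris determinant: the minor given by the (finite) index set. -/
def determinant (A : Fin (n + 1) → Finset M) (Λ : Fin (n + 1) → Set (ℝ ⊗[ℤ] M))
    (ρ : Fin (n + 1) → ℝ ⊗[ℤ] M → ℝ) (δ : ℝ ⊗[ℤ] M) : MvPolynomial (Fin (n + 1) × M) ℂ :=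
  minor A Λ ρ δ (if h : (indexSet Λ δ).Finite then h.toFinset else ∅)

open Classical in
/-- The restriction of a family of supports to a family of subsets of `M_ℝ`. -/
def restrictSupp (A : Fin (n + 1) → Finset M) (Λ : Fin (n + 1) → Set (ℝ ⊗[ℤ] M)) :
    Fin (n + 1) → Finset M :=
  fun i => (A i).filter (fun a => emb M a ∈ Λ i)

open Classical in
/-- The elements of `C` in the translate of `D` by `δ`. -/
def restrictIndex (C : Finset M) (D : Set (ℝ ⊗[ℤ] M)) (δ : ℝ ⊗[ℤ] M) : Finset M :=
  C.filter (fun b => emb M b - δ ∈ D)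

end Matrices

end CannyEmiris

end

/-! The entry at $(b,b')$ is the variable $u_{i(b),q}$ with $q=b'-b+a(b)$, or zero. Decompose
$b-\delta=\sum_j y_j$ along the components of its $\rho$-cell, so that $y_{i(b)}=a(b)$. Replacing
this summand by $q$ gives a decomposition of $b'-\delta$, which need not be optimal for $\phi$.
Hence the excess $d(b,b')=\phi_{i(b)}(q)-\phi_{i(b)}(a(b))-(\phi(b'-\delta)-\phi(b-\delta))$ is
nonnegative. Along a permutation the differences of $\phi$ cancel, so a Leibniz term has weight
$\sum_b\phi_{i(b)}(a(b))$ plus a sum of excesses. The coefficient at $\sum_b\phi_{i(b)}(a(b))$ is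
therefore the determinant of the matrix of entries of excess zero (`det_coeffs`).

Zero excess means that the exchanged decomposition is optimal, so the summands $y_j$ with $j\ne
i(b)$ lie in the components of the $\phi$-cell of $b'$. Genericity of $\delta$ then forces $b$ and
$b'$ to have the same $\phi$-cell $D$ and $q\in D_{i(b)}$ (`excess_nonneg_and_eq_zero_iff`). The
tight matrix is thus block diagonal, and its blocks are the matrices of the restricted data, because
restriction to $D$ does not change row contents (`rowContent_eq`).

It remains to see that the tight determinant is nonzero. Running the same argument on it with $\rho$
in place of $\phi$ leaves only the diagonal, since the $i(b)$-th component of the $\rho$-cell is the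
single point $a(b)$.

Genericity enters through `eq_zero_of_isGeneric`: a functional minimized at every $y_j$ over the
components of the $\rho$-cell vanishes, as tilting the cell along it would otherwise put $b-\delta$
in a cell of smaller dimension. Decompositions along cells come from linear programming duality
(`exists_support`). -/

namespace CannyEmiris

/-! ### Linear programming -/

/-- **Farkas' lemma** for finitely many linear functionals on a real vector space. -/
theorem farkas_functionals {W : Type*} [AddCommGroup W] [Module ℝ W] {m : ℕ} :
    ∀ (a : Fin m → Module.Dual ℝ W) (b : Module.Dual ℝ W),
      (∀ x, (∀ i, a i x ≤ 0) → b x ≤ 0) →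
      ∃ c : Fin m → ℝ, (∀ i, 0 ≤ c i) ∧ b = ∑ i, c i • a i := by
  induction m with
  | zero =>
    intro a b h
    refine ⟨0, by simp, ?_⟩
    ext x
    have h1 := h x (fun i => i.elim0)
    have h2 := h (-x) (fun i => i.elim0)
    simp only [map_neg] at h2
    simp only [Finset.univ_eq_empty, Finset.sum_empty, LinearMap.zero_apply]
    linarith
  | succ m ih =>
    intro a b h
    -- If the last `m` constraints already imply the conclusion, `a 0` gets coefficient zero.
    -- Otherwise a violating vector, scaled so that `a 0` equals 1 on it, splits off `ker (a 0)`.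
    by_cases hb : ∀ x, (∀ i : Fin m, a i.succ x ≤ 0) → b x ≤ 0
    · obtain ⟨c, hc, hbc⟩ := ih (fun i => a i.succ) b hb
      refine ⟨Fin.cons 0 c, ?_, ?_⟩
      · intro i
        refine Fin.cases ?_ ?_ i <;> simp [hc]
      · rw [Fin.sum_univ_succ]
        simpa using hbc
    · push Not at hb
      obtain ⟨x₁, hx₁, hbx₁⟩ := hb
      have ha₁ : 0 < a 0 x₁ := by
        by_contra hcon
        push Not at hcon
        exact absurd (h x₁ (fun i => Fin.cases hcon hx₁ i)) (not_le.2 hbx₁)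
      obtain ⟨x₀, hx₀, hbx₀, ha₀⟩ :
          ∃ x₀, (∀ i : Fin m, a i.succ x₀ ≤ 0) ∧ 0 < b x₀ ∧ a 0 x₀ = 1 := by
        refine ⟨(a 0 x₁)⁻¹ • x₁, fun i => ?_, ?_, ?_⟩
        · rw [map_smul, smul_eq_mul]
          exact mul_nonpos_of_nonneg_of_nonpos (by positivity) (hx₁ i)
        · rw [map_smul, smul_eq_mul]
          positivity
        · rw [map_smul, smul_eq_mul, inv_mul_cancel₀ ha₁.ne']
      -- These functionals are the compositions of `a i.succ` and `b` with the projection `x ↦ x - a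
      -- 0 x • x₀` onto `ker (a 0)`.
      obtain ⟨c, hc, hbc⟩ := ih (fun i => a i.succ - (a i.succ x₀) • a 0) (b - (b x₀) • a 0) (by
        intro x hx
        have hx' : ∀ i, a i (x - (a 0 x) • x₀) ≤ 0 := by
          refine Fin.cases (by simp [ha₀]) fun i => ?_
          have := hx i
          simp only [LinearMap.sub_apply, LinearMap.smul_apply, smul_eq_mul] at this
          simp only [map_sub, map_smul, smul_eq_mul]
          linarith
        have := h _ hx'
        simp only [map_sub, map_smul, smul_eq_mul] at this
        simp only [LinearMap.sub_apply, LinearMap.smul_apply, smul_eq_mul]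
        linarith)
      refine ⟨Fin.cons (b x₀ - ∑ i, c i * a i.succ x₀) c, ?_, ?_⟩
      · intro i
        refine Fin.cases ?_ ?_ i
        · have : ∑ i, c i * a i.succ x₀ ≤ 0 :=
            Finset.sum_nonpos fun i _ => mul_nonpos_of_nonneg_of_nonpos (hc i) (hx₀ i)
          simp only [Fin.cons_zero]
          linarith
        · simpa using hc
      · rw [Fin.sum_univ_succ]
        ext x
        have := congrArg (fun g : Module.Dual ℝ W => g x) hbc
        simp only [LinearMap.sub_apply, LinearMap.smul_apply, smul_eq_mul, LinearMap.sum_apply,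
          mul_sub, Finset.sum_sub_distrib] at this
        simp only [Fin.cons_zero, Fin.cons_succ, LinearMap.add_apply, LinearMap.smul_apply,
          smul_eq_mul, LinearMap.sum_apply, sub_mul, Finset.sum_mul]
        have h3 : ∑ i, c i * (a i.succ x₀ * a 0 x) = ∑ i, c i * a i.succ x₀ * a 0 x :=
          Finset.sum_congr rfl fun i _ => by ring
        rw [h3] at this
        linarith

/-- **Farkas' lemma**: a vector outside of a finitely generated cone is separated from it. -/
theorem farkas {E S : Type*} [AddCommGroup E] [Module ℝ E] [Finite S] (g : S → E) (y : E)
    (h : ∀ F : Module.Dual ℝ E, (∀ s, F (g s) ≤ 0) → F y ≤ 0) :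
    ∃ c : S → ℝ, (∀ s, 0 ≤ c s) ∧ ∀ [Fintype S], y = ∑ s, c s • g s := by
  -- Vectors are regarded as functionals on the dual space; injectivity of evaluation brings the
  -- identity back.
  obtain ⟨m, ⟨e⟩⟩ := Finite.exists_equiv_fin S
  obtain ⟨c, hc, hy⟩ := farkas_functionals (W := Module.Dual ℝ E)
    (fun i => Module.Dual.eval ℝ E (g (e.symm i))) (Module.Dual.eval ℝ E y) (by
      intro F hF
      exact h F fun s => by simpa using hF (e s))
  refine ⟨fun s => c (e s), fun s => hc _, ?_⟩
  intro _
  apply Module.eval_apply_injective (K := ℝ)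
  rw [hy, map_sum, ← e.symm.sum_comp]
  simp

/-- Complementary slackness: a point of the convex hull of the points `p s` is a convex
combination of those minimizing `f s + w (p s)` for some linear functional `w`. -/
theorem exists_support {V S : Type*} [AddCommGroup V] [Module ℝ V] [Fintype S]
    (p : S → V) (f : S → ℝ) {x : V} (hx : x ∈ convexHull ℝ (Set.range p)) :
    ∃ (w : Module.Dual ℝ V) (c : S → ℝ), (∀ s, 0 ≤ c s) ∧ ∑ s, c s = 1 ∧ ∑ s, c s • p s = x ∧
      ∀ s, c s ≠ 0 → ∀ t, f s + w (p s) ≤ f t + w (p t) := by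
  classical
  set K : Set (S → ℝ) := {c | c ∈ stdSimplex ℝ S ∧ ∑ s, c s • p s = x} with hK
  have hKne : K.Nonempty := by
    rw [convexHull_range_eq_exists_affineCombination] at hx
    obtain ⟨T, c, hc, hc1, hcx⟩ := hx
    refine ⟨fun s => if s ∈ T then c s else 0, ⟨fun s => ?_, ?_⟩, ?_⟩
    · dsimp only
      split_ifs with h
      · exact hc s h
      · exact le_rfl
    · simpa using hc1
    · rw [Finset.affineCombination_eq_linear_combination _ _ _ hc1] at hcx
      simpa [ite_smul] using hcx
  have hKc : IsCompact K := by
    refine (isCompact_stdSimplex ℝ S).inter_right (t := {c | ∑ s, c s • p s = x}) ?_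
    -- `V` carries no topology, so closedness is checked by testing the equation against all linear
    -- functionals.
    have : {c : S → ℝ | ∑ s, c s • p s = x} =
        ⋂ g : Module.Dual ℝ V, {c | ∑ s, c s * g (p s) = g x} := by
      ext c
      simp only [Set.mem_ofPred_eq, Set.mem_iInter]
      refine ⟨fun h g => by simp [← h], fun h => ?_⟩
      apply Module.eval_apply_injective (K := ℝ)
      ext g
      simpa using h g
    rw [this]
    exact isClosed_iInter fun g => isClosed_eq (by fun_prop) continuous_const
  obtain ⟨c, ⟨⟨hc0, hc1⟩, hcx⟩, hmin⟩ := hKc.exists_isMinOn hKne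
    (f := fun c => ∑ s, c s * f s) (by fun_prop)
  set z := ∑ s, c s * f s with hz
  -- Without such an `F`, Farkas puts `(0, -1)` in the cone of the lifted points; normalizing the
  -- coefficients gives a representation of `x` of cost below the minimum `z`.
  have key : ∃ F : Module.Dual ℝ (V × ℝ), (∀ s, F (p s - x, f s - z) ≤ 0) ∧ 0 < F (0, -1) := by
    by_contra hcon
    push Not at hcon
    obtain ⟨μ, hμ, hμy⟩ := farkas (fun s => (p s - x, f s - z)) ((0 : V), (-1 : ℝ)) hcon
    have h1 := congrArg Prod.fst hμy
    have h2 := congrArg Prod.snd hμy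
    simp only [Prod.fst_sum, Prod.smul_mk, Prod.snd_sum, smul_eq_mul, smul_sub, mul_sub,
      Finset.sum_sub_distrib, ← Finset.sum_smul, ← Finset.sum_mul] at h1 h2
    have hpos : 0 < ∑ s, μ s := by
      refine lt_of_le_of_ne (Finset.sum_nonneg fun s _ => hμ s) fun h0 => ?_
      have := (Finset.sum_eq_zero_iff_of_nonneg (fun s _ => hμ s)).1 h0.symm
      have h3 : ∑ s, μ s * f s = 0 := Finset.sum_eq_zero fun s hs => by rw [this s hs, zero_mul]
      rw [h3, ← h0] at h2
      norm_num at h2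
    set N := ∑ s, μ s with hN
    have hmem : (fun s => N⁻¹ * μ s) ∈ K := by
      refine ⟨⟨fun s => mul_nonneg (by positivity) (hμ s), ?_⟩, ?_⟩
      · rw [← Finset.mul_sum, inv_mul_cancel₀ hpos.ne']
      · simp only [mul_smul]
        rw [← Finset.smul_sum, sub_eq_zero.1 h1.symm, inv_smul_smul₀ hpos.ne']
    have h4 := hmin hmem
    simp only [mul_assoc, ← Finset.mul_sum, Set.mem_ofPred_eq] at h4
    have h5 : N * z ≤ ∑ s, μ s * f s := by
      have := mul_le_mul_of_nonneg_left h4 hpos.le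
      rwa [← mul_assoc, mul_inv_cancel₀ hpos.ne', one_mul] at this
    linarith
  obtain ⟨F, hF, hF0⟩ := key
  have hFdec : ∀ q : V × ℝ, F q = F (q.1, 0) - q.2 * F (0, -1) := by
    intro q
    have : q = (q.1, 0) + (-q.2) • ((0 : V), (-1 : ℝ)) := by ext <;> simp
    conv_lhs => rw [this]
    rw [map_add, map_smul, smul_eq_mul]
    ring
  set k := F (0, -1) with hk
  set w : Module.Dual ℝ V := (-k⁻¹) • (F ∘ₗ LinearMap.inl ℝ V ℝ) with hw
  have hwv : ∀ v, w v = -k⁻¹ * F (v, 0) := fun v => by simp [hw]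
  have hge : ∀ s, z + w x ≤ f s + w (p s) := by
    intro s
    have h1 := hF s
    rw [hFdec] at h1
    have h2 : F (p s - x, 0) = F (p s, 0) - F (x, 0) := by
      rw [← map_sub]; simp
    simp only [h2] at h1
    rw [hwv, hwv]
    have h3 := mul_le_mul_of_nonneg_left h1 (inv_nonneg.2 hF0.le)
    have h4 : k⁻¹ * (F (p s, 0) - F (x, 0) - (f s - z) * k) =
        k⁻¹ * F (p s, 0) - k⁻¹ * F (x, 0) - (f s - z) := by
      field_simp
    rw [h4] at h3
    linarith
  refine ⟨w, c, hc0, hc1, hcx, ?_⟩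
  have hsum : ∑ s, c s * (f s + w (p s) - (z + w x)) = 0 := by
    have : w x = ∑ s, c s * w (p s) := by rw [← hcx]; simp
    simp only [mul_sub, mul_add, Finset.sum_sub_distrib, Finset.sum_add_distrib, ← Finset.sum_mul]
    rw [hc1, this]
    simp [hz]
  have hzero := (Finset.sum_eq_zero_iff_of_nonneg (fun s _ =>
    mul_nonneg (hc0 s) (sub_nonneg.2 (hge s)))).1 hsum
  intro s hs t
  have := (mul_eq_zero.1 (hzero s (Finset.mem_univ _))).resolve_left hs
  linarith [hge t]

/-- A convex combination lies in the convex hull of the points with nonzero weight. -/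
theorem sum_smul_mem_convexHull {V S : Type*} [AddCommGroup V] [Module ℝ V] [Fintype S]
    {T : Set V} (c : S → ℝ) (q : S → V) (hc : ∀ s, 0 ≤ c s) (hc1 : ∑ s, c s = 1)
    (hq : ∀ s, c s ≠ 0 → q s ∈ T) : ∑ s, c s • q s ∈ convexHull ℝ T := by
  classical
  have h1 : ∑ s with c s ≠ 0, c s • q s = ∑ s, c s • q s :=
    Finset.sum_filter_of_ne fun s _ h h0 => h (by rw [h0, zero_smul])
  rw [← h1]
  refine (convex_convexHull ℝ T).sum_mem (fun s _ => hc s) ?_ fun s hs =>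
    subset_convexHull ℝ T (hq s (Finset.mem_filter.1 hs).2)
  rw [Finset.sum_filter_ne_zero, hc1]

/-! ### Cells of mixed subdivisions -/

section

variable {V ι : Type*} [AddCommGroup V] [Fintype ι] {Λ : ι → Set V} {ψ : ι → V → ℝ}

theorem mem_sum_iff {x : V} : x ∈ ∑ i, Λ i ↔ ∃ y : ι → V, (∀ i, y i ∈ Λ i) ∧ ∑ i, y i = x := by
  rw [Set.mem_fintype_sum]
  simp

theorem infConv_le (hb : ∀ i, BddBelow (ψ i '' Λ i)) {y : ι → V} (hy : ∀ i, y i ∈ Λ i) :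
    infConv Λ ψ (∑ i, y i) ≤ ∑ i, ψ i (y i) := by
  choose c hc using hb
  refine csInf_le ⟨∑ i, c i, ?_⟩ ⟨y, hy, rfl, rfl⟩
  rintro _ ⟨z, hz, -, rfl⟩
  exact Finset.sum_le_sum fun i _ => hc i ⟨z i, hz i, rfl⟩

end

section Cells

variable {V : Type*} [AddCommGroup V] [Module ℝ V]

/-- The last coordinate of the direction `(v, 1)` is positive, so the face of the epigraph lies on
the graph. All later arguments use this form. -/
theorem mem_cell {Λ : Set V} {ψ : V → ℝ} {v : Module.Dual ℝ V} {x : V} :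
    x ∈ cell Λ ψ v ↔ x ∈ Λ ∧ ∀ y ∈ Λ, ψ x + v x ≤ ψ y + v y := by
  simp only [cell, face, epi, Set.mem_image, Set.mem_ofPred_eq, Prod.exists, LinearMap.coprod_apply,
    LinearMap.id_apply, Prod.forall, exists_and_right, exists_eq_right, and_imp]
  constructor
  · rintro ⟨z, ⟨hx, hz⟩, h⟩
    refine ⟨hx, fun y hy => ?_⟩
    have := h y (ψ y) hy le_rfl
    linarith
  · rintro ⟨hx, h⟩
    refine ⟨ψ x, ⟨hx, le_rfl⟩, fun y z hy hz => ?_⟩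
    have := h y hy
    linarith

theorem cell_subset (Λ : Set V) (ψ : V → ℝ) (v : Module.Dual ℝ V) : cell Λ ψ v ⊆ Λ :=
  fun _ hx => (mem_cell.1 hx).1

/-- The minimum over `Λ` is attained inside `Λ'`, so both minima agree. This transfers `ρ`-cells to
the restricted polytopes `D_i`. -/
theorem cell_eq_of_subset {Λ Λ' : Set V} {ψ : V → ℝ} {v : Module.Dual ℝ V}
    (hne : (cell Λ ψ v).Nonempty) (h : cell Λ ψ v ⊆ Λ') (h' : Λ' ⊆ Λ) :
    cell Λ' ψ v = cell Λ ψ v := by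
  obtain ⟨z, hz⟩ := hne
  ext x
  constructor
  · intro hx
    rw [mem_cell] at hx ⊢
    exact ⟨h' hx.1, fun y hy => (hx.2 z (h hz)).trans ((mem_cell.1 hz).2 y hy)⟩
  · intro hx
    exact mem_cell.2 ⟨h hx, fun y hy => (mem_cell.1 hx).2 y (h' hy)⟩

variable {ι : Type*} [Fintype ι] {Λ : ι → Set V} {ψ : ι → V → ℝ} {v : Module.Dual ℝ V}

theorem infConv_eq_sum {y : ι → V} (hy : ∀ i, y i ∈ cell (Λ i) (ψ i) v) :
    infConv Λ ψ (∑ i, y i) = ∑ i, ψ i (y i) := by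
  refine IsLeast.csInf_eq ⟨⟨y, fun i => (mem_cell.1 (hy i)).1, rfl, rfl⟩, ?_⟩
  rintro _ ⟨z, hz, hzy, rfl⟩
  have h1 : ∑ i, (ψ i (y i) + v (y i)) ≤ ∑ i, (ψ i (z i) + v (z i)) :=
    Finset.sum_le_sum fun i _ => (mem_cell.1 (hy i)).2 _ (hz i)
  rw [Finset.sum_add_distrib, Finset.sum_add_distrib, ← map_sum, ← map_sum, hzy] at h1
  linarith

theorem sum_mem_cell {y : ι → V} (hy : ∀ i, y i ∈ cell (Λ i) (ψ i) v) :
    ∑ i, y i ∈ cell (∑ i, Λ i) (infConv Λ ψ) v := by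
  refine mem_cell.2 ⟨mem_sum_iff.2 ⟨y, fun i => (mem_cell.1 (hy i)).1, rfl⟩, fun x hx => ?_⟩
  rw [infConv_eq_sum hy, ← sub_le_iff_le_add]
  obtain ⟨z₀, hz₀, hzx₀⟩ := mem_sum_iff.1 hx
  refine le_csInf ⟨_, z₀, hz₀, hzx₀, rfl⟩ ?_
  rintro _ ⟨z, hz, rfl, rfl⟩
  have h1 : ∑ i, (ψ i (y i) + v (y i)) ≤ ∑ i, (ψ i (z i) + v (z i)) :=
    Finset.sum_le_sum fun i _ => (mem_cell.1 (hy i)).2 _ (hz i)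
  rw [Finset.sum_add_distrib, Finset.sum_add_distrib, ← map_sum, ← map_sum] at h1
  linarith

theorem sum_apply_update {X Y : Type*} [AddCommGroup Y] [DecidableEq ι] (g : ι → X → Y)
    (y : ι → X) (i : ι) (z : X) : ∑ j, g j (Function.update y i z j) = ∑ j, g j (y j) - g i (y i) + g i z := by
  rw [← Finset.add_sum_erase _ _ (Finset.mem_univ i),
    ← Finset.add_sum_erase Finset.univ (fun j => g j (y j)) (Finset.mem_univ i)]
  have : ∑ j ∈ Finset.univ.erase i, g j (Function.update y i z j) =
      ∑ j ∈ Finset.univ.erase i, g j (y j) :=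
    Finset.sum_congr rfl fun j hj => by
      rw [Function.update_of_ne (Finset.ne_of_mem_erase hj)]
  rw [this, Function.update_self]
  abel

/-- An exchange argument: replacing only `y i` by `z` cannot lower the total, and the other summands
cancel. -/
theorem mem_cell_of_sum_mem_cell (hb : ∀ i, BddBelow (ψ i '' Λ i)) {y : ι → V}
    (hy : ∀ i, y i ∈ Λ i) (hyv : ∑ i, y i ∈ cell (∑ i, Λ i) (infConv Λ ψ) v)
    (hyψ : infConv Λ ψ (∑ i, y i) = ∑ i, ψ i (y i)) (i : ι) : y i ∈ cell (Λ i) (ψ i) v := by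
  classical
  refine mem_cell.2 ⟨hy i, fun z hz => ?_⟩
  have hz' : ∀ j, Function.update y i z j ∈ Λ j := fun j => by
    by_cases h : j = i
    · subst h
      simpa using hz
    · simpa [h] using hy j
  have h1 := (mem_cell.1 hyv).2 _ (mem_sum_iff.2 ⟨_, hz', rfl⟩)
  have h2 := infConv_le hb hz'
  rw [sum_apply_update] at h2
  have h3 : ∑ j, Function.update y i z j = ∑ j, y j - y i + z :=
    sum_apply_update (fun _ x => x) y i z
  rw [hyψ] at h1
  have h4 := congrArg v h3
  rw [map_add, map_sub] at h4
  linarith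

theorem component_subset_cell (hb : ∀ i, BddBelow (ψ i '' Λ i)) (i : ι) :
    component Λ ψ (cell (∑ i, Λ i) (infConv Λ ψ) v) i ⊆ cell (Λ i) (ψ i) v := by
  rintro _ ⟨y, ⟨hy, hyv, hyψ⟩, rfl⟩
  exact mem_cell_of_sum_mem_cell hb hy hyv hyψ i

/-- Nonemptiness is needed for every index, as a point of one component must extend to a full
optimal tuple. -/
theorem component_eq_cell (hb : ∀ i, BddBelow (ψ i '' Λ i))
    (hne : ∀ i, (cell (Λ i) (ψ i) v).Nonempty) (i : ι) :
    component Λ ψ (cell (∑ i, Λ i) (infConv Λ ψ) v) i = cell (Λ i) (ψ i) v := by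
  classical
  refine (component_subset_cell hb i).antisymm fun z hz => ?_
  choose y hy using hne
  have hz' : ∀ j, Function.update y i z j ∈ cell (Λ j) (ψ j) v := fun j => by
    by_cases h : j = i
    · subst h
      simpa using hz
    · simpa [h] using hy j
  exact ⟨Function.update y i z, ⟨fun j => (mem_cell.1 (hz' j)).1, sum_mem_cell hz',
    infConv_eq_sum hz'⟩, by simp⟩

end Cells

/-! ### Lower envelopes -/

section Envelope

variable {M : Type*} [AddCommGroup M]

/-- The points of `A` minimizing `ν + w`. -/
def minVertices (A : Finset M) (ν : M → ℝ) (w : Module.Dual ℝ (ℝ ⊗[ℤ] M)) : Set M :=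
  {a | a ∈ A ∧ ∀ a' ∈ A, ν a + w (emb M a) ≤ ν a' + w (emb M a')}

theorem minVertices_nonempty {A : Finset M} (hA : A.Nonempty) (ν : M → ℝ)
    (w : Module.Dual ℝ (ℝ ⊗[ℤ] M)) : (minVertices A ν w).Nonempty := by
  obtain ⟨a, ha, h⟩ := A.exists_min_image (fun a => ν a + w (emb M a)) hA
  exact ⟨a, ha, h⟩

theorem emb_mem_newton {A : Finset M} {a : M} (ha : a ∈ A) : emb M a ∈ newton A :=
  subset_convexHull ℝ _ ⟨a, ha, rfl⟩

theorem le_of_mem_convexHull_lift {A : Finset M} {ν : M → ℝ} {w : Module.Dual ℝ (ℝ ⊗[ℤ] M)}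
    {c : ℝ} (hc : ∀ a ∈ A, c ≤ ν a + w (emb M a)) {q : (ℝ ⊗[ℤ] M) × ℝ}
    (hq : q ∈ convexHull ℝ ((fun a => (emb M a, ν a)) '' (A : Set M))) : c ≤ q.2 + w q.1 := by
  have hconv : Convex ℝ {q : (ℝ ⊗[ℤ] M) × ℝ | c ≤ (w.coprod LinearMap.id) q} :=
    convex_halfSpace_ge (w.coprod LinearMap.id).isLinear c
  have := convexHull_min (s := (fun a => (emb M a, ν a)) '' (A : Set M)) (by
    rintro _ ⟨a, ha, rfl⟩
    have := hc a ha
    simp only [Set.mem_ofPred_eq, LinearMap.coprod_apply, LinearMap.id_apply]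
    linarith) hconv hq
  simp only [Set.mem_ofPred_eq, LinearMap.coprod_apply, LinearMap.id_apply] at this
  linarith

theorem exists_mem_convexHull_lift {A : Finset M} (ν : M → ℝ) {y : ℝ ⊗[ℤ] M}
    (hy : y ∈ newton A) :
    ∃ z, (y, z) ∈ convexHull ℝ ((fun a => (emb M a, ν a)) '' (A : Set M)) := by
  have h : newton A = LinearMap.fst ℝ (ℝ ⊗[ℤ] M) ℝ ''
      convexHull ℝ ((fun a => (emb M a, ν a)) '' (A : Set M)) := by
    rw [LinearMap.image_convexHull, Set.image_image]
    rfl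
  rw [h] at hy
  obtain ⟨⟨y', z⟩, hz, rfl⟩ := hy
  exact ⟨z, hz⟩

theorem lowerEnvelope_le {A : Finset M} {ν : M → ℝ} {y : ℝ ⊗[ℤ] M} {z : ℝ}
    (h : (y, z) ∈ convexHull ℝ ((fun a => (emb M a, ν a)) '' (A : Set M))) :
    lowerEnvelope A ν y ≤ z := by
  have hA : A.Nonempty := by
    rw [Finset.nonempty_iff_ne_empty]
    rintro rfl
    simp at h
  obtain ⟨a, ha, hmin⟩ := minVertices_nonempty hA ν 0
  refine csInf_le ⟨ν a, ?_⟩ h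
  intro z' hz'
  simpa using le_of_mem_convexHull_lift (w := 0) (by simpa using hmin) hz'

variable {A : Finset M} {ν : M → ℝ} {f : ℝ ⊗[ℤ] M → ℝ} {w : Module.Dual ℝ (ℝ ⊗[ℤ] M)}

theorem le_envelope (hf : Set.EqOn f (lowerEnvelope A ν) (newton A)) {c : ℝ}
    (hc : ∀ a ∈ A, c ≤ ν a + w (emb M a)) {y : ℝ ⊗[ℤ] M} (hy : y ∈ newton A) :
    c ≤ f y + w y := by
  rw [hf hy, ← sub_le_iff_le_add]
  obtain ⟨z₀, hz₀⟩ := exists_mem_convexHull_lift ν hy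
  refine le_csInf ⟨z₀, hz₀⟩ fun z hz => ?_
  have := le_of_mem_convexHull_lift hc hz
  linarith

theorem envelope_add_eq (hf : Set.EqOn f (lowerEnvelope A ν) (newton A)) {a : M}
    (ha : a ∈ minVertices A ν w) {y : ℝ ⊗[ℤ] M}
    (hy : y ∈ convexHull ℝ (emb M '' minVertices A ν w)) :
    y ∈ newton A ∧ f y + w y = ν a + w (emb M a) := by
  have hyA : y ∈ newton A :=
    convexHull_mono (Set.image_mono fun b (hb : b ∈ minVertices A ν w) => hb.1) hy
  refine ⟨hyA, le_antisymm ?_ (le_envelope hf ha.2 hyA)⟩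
  rw [hf hyA, ← le_sub_iff_add_le]
  apply lowerEnvelope_le
  set m := ν a + w (emb M a) with hm
  -- The lift `y ↦ (y, m - w y)` is affine and sends each minimizing vertex to its lifted point, so
  -- it sends their hull into the lifted hull.
  have hconv : Convex ℝ {y : ℝ ⊗[ℤ] M |
      (y, m - w y) ∈ convexHull ℝ ((fun a => (emb M a, ν a)) '' (A : Set M))} := by
    intro y₁ h₁ y₂ h₂ s t hs ht hst
    have h3 := convex_convexHull ℝ ((fun a => (emb M a, ν a)) '' (A : Set M)) h₁ h₂ hs ht hst
    simp only [Set.mem_ofPred_eq]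
    convert h3 using 1
    ext
    · simp
    · simp only [map_add, map_smul, smul_eq_mul, Prod.snd_add, Prod.smul_snd]
      linear_combination (-m) * hst
  refine convexHull_min ?_ hconv hy
  rintro _ ⟨b, hb, rfl⟩
  refine subset_convexHull ℝ _ ⟨b, hb.1, ?_⟩
  have h1 := hb.2 a ha.1
  have h2 := ha.2 b hb.1
  ext
  · rfl
  · simp only
    linarith

/-- The cells of a lower envelope are the convex hulls of their vertices. -/
theorem cell_envelope (hA : A.Nonempty) (hf : Set.EqOn f (lowerEnvelope A ν) (newton A))
    (w : Module.Dual ℝ (ℝ ⊗[ℤ] M)) :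
    cell (newton A) f w = convexHull ℝ (emb M '' minVertices A ν w) := by
  obtain ⟨a, ha⟩ := minVertices_nonempty hA ν w
  ext y
  constructor
  · intro hy
    obtain ⟨hyA, hmin⟩ := mem_cell.1 hy
    have hyr : y ∈ convexHull ℝ (Set.range fun b : A => emb M b) := by
      convert hyA using 1
      rw [newton]
      congr 1
      ext x
      simp
    -- These weights realize the envelope value at `y`. The functional `w'` only certifies this and
    -- need not be `w`; slackness for `w` follows from the minimality of `y`.
    obtain ⟨w', c, hc, hc1, rfl, hsupp⟩ :=
      exists_support (fun b : A => emb M b) (fun b : A => ν b) hyr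
    set y := ∑ b : A, c b • emb M b with hy'
    obtain ⟨b₀, hb₀⟩ : ∃ b, c b ≠ 0 := by
      by_contra hcon
      push Not at hcon
      simp [hcon] at hc1
    have h1 : ν b₀ + w' (emb M b₀) ≤ f y + w' y :=
      le_envelope hf (fun b hb => hsupp b₀ hb₀ ⟨b, hb⟩) hyA
    have hlin : ∀ u : Module.Dual ℝ (ℝ ⊗[ℤ] M), u y = ∑ b, c b * u (emb M b) := fun u => by
      rw [hy', map_sum]
      simp
    have h2 : ∑ b, c b * (ν b + w' (emb M b)) = ν b₀ + w' (emb M b₀) := by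
      have : ∀ b, c b * (ν b + w' (emb M b)) = c b * (ν b₀ + w' (emb M b₀)) := fun b => by
        by_cases hb : c b = 0
        · rw [hb, zero_mul, zero_mul]
        · rw [le_antisymm (hsupp b hb b₀) (hsupp b₀ hb₀ b)]
      rw [Finset.sum_congr rfl fun b _ => this b, ← Finset.sum_mul, hc1, one_mul]
    have h3 : ∑ b, c b * ν b ≤ f y := by
      simp only [mul_add, Finset.sum_add_distrib] at h2
      rw [← hlin] at h2
      linarith
    have h4 : f y + w y ≤ ν a + w (emb M a) := by
      have h5 := envelope_add_eq hf ha (subset_convexHull ℝ _ ⟨a, ha, rfl⟩)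
      rw [← h5.2]
      exact hmin _ h5.1
    have h6 : ∑ b, c b * (ν b + w (emb M b) - (ν a + w (emb M a))) ≤ 0 := by
      simp only [mul_sub, mul_add, Finset.sum_sub_distrib, Finset.sum_add_distrib,
        ← Finset.sum_mul]
      rw [← hlin, hc1]
      linarith
    have hnn : ∀ b ∈ Finset.univ, 0 ≤ c b * (ν b + w (emb M b) - (ν a + w (emb M a))) :=
      fun b _ => mul_nonneg (hc b) (sub_nonneg.2 (ha.2 b b.2))
    have h7 := (Finset.sum_eq_zero_iff_of_nonneg hnn).1 (le_antisymm h6 (Finset.sum_nonneg hnn))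
    refine sum_smul_mem_convexHull c _ hc hc1 fun b hb => ⟨b, ⟨b.2, fun a' ha' => ?_⟩, rfl⟩
    have := (mul_eq_zero.1 (h7 b (Finset.mem_univ _))).resolve_left hb
    linarith [ha.2 a' ha']
  · intro hy
    obtain ⟨hyA, h⟩ := envelope_add_eq hf ha hy
    refine mem_cell.2 ⟨hyA, fun z hz => ?_⟩
    rw [h]
    exact le_envelope hf ha.2 hz

theorem cell_envelope_nonempty (hA : A.Nonempty)
    (hf : Set.EqOn f (lowerEnvelope A ν) (newton A)) (w : Module.Dual ℝ (ℝ ⊗[ℤ] M)) :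
    ∃ a ∈ A, emb M a ∈ cell (newton A) f w := by
  obtain ⟨a, ha⟩ := minVertices_nonempty hA ν w
  rw [cell_envelope hA hf]
  exact ⟨a, ha.1, subset_convexHull ℝ _ ⟨a, ha, rfl⟩⟩

theorem bddBelow_envelope (hA : A.Nonempty) (hf : Set.EqOn f (lowerEnvelope A ν) (newton A)) :
    BddBelow (f '' newton A) := by
  obtain ⟨a, ha⟩ := minVertices_nonempty hA ν 0
  refine ⟨ν a, ?_⟩
  rintro _ ⟨y, hy, rfl⟩
  simpa using le_envelope (w := 0) (c := ν a) hf (by simpa using ha.2) hy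

theorem bddBelow_linear_newton (hA : A.Nonempty) (l : (ℝ ⊗[ℤ] M) →ₗ[ℝ] ℝ) :
    ∃ c, ∀ y ∈ newton A, c ≤ l y := by
  obtain ⟨a, ha⟩ := minVertices_nonempty hA 0 l
  refine ⟨l (emb M a), fun y hy => ?_⟩
  refine convexHull_min (s := emb M '' (A : Set M)) ?_
    (convex_halfSpace_ge l.isLinear (l (emb M a))) hy
  rintro _ ⟨b, hb, rfl⟩
  simpa using ha.2 b hb

/-- Each of the finitely many affine pieces is bounded below on the polytope. This makes the real
infimum in `infConv` a true lower bound. -/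
theorem IsConvexPiecewiseAffineOn.bddBelow (hA : A.Nonempty)
    (hf : IsConvexPiecewiseAffineOn (newton A) f) : BddBelow (f '' newton A) := by
  obtain ⟨-, k, P, -, hP, hl⟩ := hf
  choose l hl using hl
  choose c hc using fun j => bddBelow_linear_newton hA (l j).linear
  obtain ⟨B, hB⟩ := (Set.finite_range fun j => c j + l j 0).bddBelow
  refine ⟨B, ?_⟩
  rintro _ ⟨y, hy, rfl⟩
  obtain ⟨j, hj⟩ := Set.mem_iUnion.1 (hP ▸ hy)
  rw [hl j hj]
  refine (hB ⟨j, rfl⟩).trans ?_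
  have h1 : l j y = (l j).linear y + l j 0 := by
    rw [AffineMap.decomp']
    simp
  rw [h1]
  linarith [hc j y hy]

/-! ### Mixed subdivisions by lower envelopes -/

variable {ι : Type*} [Fintype ι] {As : ι → Finset M} {νs : ι → M → ℝ}
  {ρ : ι → ℝ ⊗[ℤ] M → ℝ}

/-- Duality is applied to the sums of tuples of vertices with total heights. A minimizing tuple
minimizes in each entry, so one set of weights on tuples gives points in all cells of a common
direction. -/
theorem exists_mem_cell_envelope (hA : ∀ i, (As i).Nonempty)
    (hρ : ∀ i, Set.EqOn (ρ i) (lowerEnvelope (As i) (νs i)) (newton (As i)))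
    {x : ℝ ⊗[ℤ] M} (hx : x ∈ ∑ i, newton (As i)) :
    ∃ (w : Module.Dual ℝ (ℝ ⊗[ℤ] M)) (y : ι → ℝ ⊗[ℤ] M),
      (∀ i, y i ∈ cell (newton (As i)) (ρ i) w) ∧ ∑ i, y i = x := by
  classical
  have hx' : x ∈ convexHull ℝ (Set.range fun s : ∀ i, As i => ∑ i, emb M (s i)) := by
    simp only [newton] at hx
    rw [← convexHull_sum] at hx
    refine convexHull_mono ?_ hx
    intro z hz
    obtain ⟨g, hg, rfl⟩ := mem_sum_iff.1 hz
    choose s hs hsg using hg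
    exact ⟨fun i => ⟨s i, hs i⟩, by simp [hsg]⟩
  obtain ⟨w, c, hc, hc1, hcx, hsupp⟩ := exists_support _ (fun s => ∑ i, νs i (s i)) hx'
  refine ⟨w, fun i => ∑ s, c s • emb M (s i), fun i => ?_, ?_⟩
  · rw [cell_envelope (hA i) (hρ i)]
    refine sum_smul_mem_convexHull c _ hc hc1 fun s hs => ⟨s i, ⟨(s i).2, fun a ha => ?_⟩, rfl⟩
    have h1 := hsupp s hs (Function.update s i ⟨a, ha⟩)
    simp only [map_sum, ← Finset.sum_add_distrib] at h1
    rw [← Finset.add_sum_erase _ _ (Finset.mem_univ i),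
      ← Finset.add_sum_erase Finset.univ
        (fun j => νs j (Function.update s i ⟨a, ha⟩ j) + _) (Finset.mem_univ i),
      Finset.sum_congr (s₁ := Finset.univ.erase i) rfl fun j hj => by
        rw [← Function.update_of_ne (Finset.ne_of_mem_erase hj) (⟨a, ha⟩ : As i) s],
      Function.update_self] at h1
    exact le_of_add_le_add_right h1
  · rw [Finset.sum_comm, ← hcx]
    simp only [Finset.smul_sum]

/-- Perturbing `w` in a direction `u` yields subsets of the cells in the direction `w` on which
`u` is minimal. -/
theorem exists_perturbation (hA : ∀ i, (As i).Nonempty)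
    (hρ : ∀ i, Set.EqOn (ρ i) (lowerEnvelope (As i) (νs i)) (newton (As i)))
    {w u : Module.Dual ℝ (ℝ ⊗[ℤ] M)} {y : ι → ℝ ⊗[ℤ] M}
    (hy : ∀ i, y i ∈ cell (newton (As i)) (ρ i) w)
    (hu : ∀ i, ∀ z ∈ cell (newton (As i)) (ρ i) w, u (y i) ≤ u z) :
    ∃ w' : Module.Dual ℝ (ℝ ⊗[ℤ] M), ∀ i, y i ∈ cell (newton (As i)) (ρ i) w' ∧
      ∀ z ∈ cell (newton (As i)) (ρ i) w', u z = u (y i) := by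
  -- The finitely many strict inequalities at non-minimal vertices survive a small tilt, so only
  -- vertices minimal for `w` can compete for `w + ε • u`.
  have hfin : ∀ᶠ ε : ℝ in nhdsWithin 0 (Set.Ioi 0), ∀ i, ∀ a ∈ As i,
      a ∉ minVertices (As i) (νs i) w → ∀ b ∈ minVertices (As i) (νs i) w,
        νs i b + w (emb M b) + ε * u (y i) < νs i a + w (emb M a) + ε * u (emb M a) := by
    rw [Filter.eventually_all]
    intro i
    rw [Filter.eventually_all_finset]
    intro a ha
    by_cases ham : a ∈ minVertices (As i) (νs i) w
    · simp [ham]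
    obtain ⟨b₀, hb₀⟩ := minVertices_nonempty (hA i) (νs i) w
    have hlt : νs i b₀ + w (emb M b₀) < νs i a + w (emb M a) := by
      by_contra hcon
      exact ham ⟨ha, fun a' ha' => (not_lt.1 hcon).trans (hb₀.2 a' ha')⟩
    have h1 : Filter.Tendsto (fun ε : ℝ => νs i b₀ + w (emb M b₀) + ε * u (y i))
        (nhdsWithin 0 (Set.Ioi 0)) (nhds (νs i b₀ + w (emb M b₀) + 0 * u (y i))) :=
      (Continuous.tendsto (by fun_prop) 0).mono_left nhdsWithin_le_nhds
    have h2 : Filter.Tendsto (fun ε : ℝ => νs i a + w (emb M a) + ε * u (emb M a))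
        (nhdsWithin 0 (Set.Ioi 0)) (nhds (νs i a + w (emb M a) + 0 * u (emb M a))) :=
      (Continuous.tendsto (by fun_prop) 0).mono_left nhdsWithin_le_nhds
    filter_upwards [h1.eventually_lt h2 (by simpa using hlt)] with ε hε _ b hb
    have := hb.2 b₀ hb₀.1
    linarith
  obtain ⟨ε, hε, hε0⟩ := (hfin.and self_mem_nhdsWithin).exists
  have hε0 : 0 < ε := hε0
  have hval : ∀ z, (w + ε • u) z = w z + ε * u z := fun z => by simp
  have hmin : ∀ i, ∀ b ∈ minVertices (As i) (νs i) w, ∀ a ∈ As i,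
      νs i b + w (emb M b) + ε * u (y i) ≤ νs i a + (w + ε • u) (emb M a) ∧
      (νs i b + w (emb M b) + ε * u (y i) = νs i a + (w + ε • u) (emb M a) →
        u (emb M a) = u (y i)) := by
    intro i b hb a ha
    rw [hval]
    by_cases ham : a ∈ minVertices (As i) (νs i) w
    · have h1 : u (y i) ≤ u (emb M a) := by
        apply hu i
        rw [cell_envelope (hA i) (hρ i)]
        exact subset_convexHull ℝ _ ⟨a, ham, rfl⟩
      have h2 := hb.2 a ha
      have h3 := ham.2 b hb.1
      have h4 := mul_le_mul_of_nonneg_left h1 hε0.le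
      refine ⟨by linarith, fun h => ?_⟩
      exact mul_left_cancel₀ hε0.ne' (by linarith)
    · have := hε i a ha ham b hb
      exact ⟨by linarith, fun h => by linarith⟩
  refine ⟨w + ε • u, fun i => ?_⟩
  obtain ⟨b, hb⟩ := minVertices_nonempty (hA i) (νs i) w
  have hyi := hy i
  rw [cell_envelope (hA i) (hρ i)] at hyi
  obtain ⟨hyA, hyb⟩ := envelope_add_eq (hρ i) hb hyi
  have hycell : y i ∈ cell (newton (As i)) (ρ i) (w + ε • u) := by
    refine mem_cell.2 ⟨hyA, fun z hz => ?_⟩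
    rw [hval, ← add_assoc, hyb]
    exact le_envelope (hρ i) (fun a ha => (hmin i b hb a ha).1) hz
  refine ⟨hycell, fun z hz => ?_⟩
  obtain ⟨c, hc⟩ := minVertices_nonempty (hA i) (νs i) (w + ε • u)
  have hcval : νs i c + (w + ε • u) (emb M c) = νs i b + w (emb M b) + ε * u (y i) := by
    rw [cell_envelope (hA i) (hρ i)] at hycell
    rw [← (envelope_add_eq (hρ i) hc hycell).2, hval, ← add_assoc, hyb]
  rw [cell_envelope (hA i) (hρ i)] at hz
  have hconv : Convex ℝ {z | u z = u (y i)} := convex_hyperplane u.isLinear _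
  refine convexHull_min ?_ hconv hz
  rintro _ ⟨a, ha, rfl⟩
  refine (hmin i b hb a ha.1).2 ?_
  rw [← hcval]
  exact le_antisymm (hc.2 a ha.1) (ha.2 c hc.1)

end Envelope

/-! ### Initial parts of determinants -/

section Determinants

variable {σ : Type*}

theorem prod_single {R κ : Type*} [CommSemiring R] (s : Finset κ) (e : κ → ℝ) (c : κ → R) :
    ∏ i ∈ s, AddMonoidAlgebra.single (e i) (c i) =
      AddMonoidAlgebra.single (∑ i ∈ s, e i) (∏ i ∈ s, c i) := by
  classical
  induction s using Finset.induction_on with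
  | empty => simp [AddMonoidAlgebra.one_def]
  | insert a s ha ih =>
    rw [Finset.prod_insert ha, Finset.sum_insert ha, Finset.prod_insert ha, ih,
      AddMonoidAlgebra.single_mul_single]

theorem weighted_X (ω : σ → ℝ) (s : σ) :
    weighted ω (MvPolynomial.X s) = AddMonoidAlgebra.single (ω s) (MvPolynomial.X s) := by
  simp [weighted]

theorem weighted_zero (ω : σ → ℝ) : weighted ω (0 : MvPolynomial σ ℂ) = 0 := by
  simp [weighted]

variable {m : Type*} [Fintype m] [DecidableEq m]

open Classical in
/-- The entries of excess zero of a matrix. -/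
noncomputable def tightPart (P : Matrix m m (MvPolynomial σ ℂ)) (d : m → m → ℝ) :
    Matrix m m (MvPolynomial σ ℂ) :=
  fun i j => if d i j = 0 then P i j else 0

variable {ω : σ → ℝ} {P : Matrix m m (MvPolynomial σ ℂ)} {e d : m → m → ℝ} {f g : m → ℝ}

theorem coeff_weighted_det (he : ∀ i j, weighted ω (P i j) = AddMonoidAlgebra.single (e i j) (P i j))
    (r : ℝ) :
    (weighted ω P.det).coeff r = ∑ τ : Equiv.Perm m, (Equiv.Perm.sign τ : ℤ) •
      if ∑ i, e (τ i) i = r then ∏ i, P (τ i) i else 0 := by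
  have h1 : weighted ω P.det = ∑ τ : Equiv.Perm m, (Equiv.Perm.sign τ : ℤ) •
      AddMonoidAlgebra.single (∑ i, e (τ i) i) (∏ i, P (τ i) i) := by
    simp only [weighted] at he ⊢
    rw [Matrix.det_apply, map_sum]
    refine Finset.sum_congr rfl fun τ _ => ?_
    rw [← prod_single, Units.smul_def, map_zsmul, map_prod]
    simp only [he]
  rw [h1, AddMonoidAlgebra.coeff_sum, Finsupp.finsetSum_apply]
  refine Finset.sum_congr rfl fun τ _ => ?_
  rw [AddMonoidAlgebra.coeff_smul, Finsupp.smul_apply, AddMonoidAlgebra.coeff_single,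
    Finsupp.single_apply]

/-- The potential `g` cancels along a permutation, so each term has weight `∑ f` plus its sum of
excesses. The tight determinant may still vanish; that is excluded separately. -/
theorem det_coeffs (he : ∀ i j, weighted ω (P i j) = AddMonoidAlgebra.single (e i j) (P i j))
    (hd : ∀ i j, P i j ≠ 0 → 0 ≤ d i j) (hed : ∀ i j, e i j = f i + (g j - g i) + d i j) :
    (weighted ω P.det).coeff (∑ i, f i) = (tightPart P d).det ∧
      ∀ r < ∑ i, f i, (weighted ω P.det).coeff r = 0 := by
  have hsum : ∀ τ : Equiv.Perm m, ∑ i, e (τ i) i = ∑ i, f i + ∑ i, d (τ i) i := by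
    intro τ
    simp only [hed, Finset.sum_add_distrib, Finset.sum_sub_distrib]
    rw [Equiv.sum_comp τ f, Equiv.sum_comp τ g]
    ring
  constructor
  · rw [coeff_weighted_det he, Matrix.det_apply]
    refine Finset.sum_congr rfl fun τ _ => ?_
    rw [Units.smul_def]
    congr 1
    simp only [hsum, add_eq_left]
    -- The sign of `d` is known only at nonzero entries.
    by_cases h0 : ∏ i, P (τ i) i = 0
    · rw [h0, ite_self]
      obtain ⟨i, hi, hP⟩ := Finset.prod_eq_zero_iff.1 h0
      exact (Finset.prod_eq_zero hi (by simp [tightPart, hP])).symm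
    have hnn : ∀ i ∈ Finset.univ, 0 ≤ d (τ i) i := fun i hi =>
      hd _ _ fun h => h0 (Finset.prod_eq_zero hi h)
    split_ifs with h
    · have := (Finset.sum_eq_zero_iff_of_nonneg hnn).1 h
      exact Finset.prod_congr rfl fun i hi => by rw [tightPart, if_pos (this i hi)]
    · obtain ⟨i, hi, hdi⟩ : ∃ i ∈ Finset.univ, d (τ i) i ≠ 0 := by
        by_contra hcon
        push Not at hcon
        exact h (Finset.sum_eq_zero hcon)
      exact (Finset.prod_eq_zero hi (by simp [tightPart, hdi])).symm
  · intro r hr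
    rw [coeff_weighted_det he]
    refine Finset.sum_eq_zero fun τ _ => ?_
    split_ifs with h
    · rw [hsum] at h
      have h0 : ∏ i, P (τ i) i = 0 := by
        by_contra h0
        have : 0 ≤ ∑ i, d (τ i) i := Finset.sum_nonneg fun i hi =>
          hd _ _ fun h => h0 (Finset.prod_eq_zero hi h)
        linarith
      rw [h0, smul_zero]
    · rw [smul_zero]

theorem ord_init_eq {ω : σ → ℝ} {Q : MvPolynomial σ ℂ} {s : ℝ} {R : MvPolynomial σ ℂ}
    (hs : (weighted ω Q).coeff s = R) (hR : R ≠ 0)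
    (hlt : ∀ r < s, (weighted ω Q).coeff r = 0) :
    ord ω Q = (s : WithTop ℝ) ∧ init ω Q = R := by
  have h : ord ω Q = (s : WithTop ℝ) := by
    refine le_antisymm (Finset.min_le (Finsupp.mem_support_iff.2 (hs ▸ hR))) ?_
    refine Finset.le_min fun r hr => ?_
    by_contra hcon
    exact Finsupp.mem_support_iff.1 hr (hlt r (WithTop.coe_lt_coe.1 (not_le.1 hcon)))
  exact ⟨h, by rw [init, h]; exact hs⟩

/-- The determinant of a matrix that is block diagonal with respect to a labelling. -/
theorem det_eq_prod_blocks {R L : Type*} [CommRing R] [DecidableEq L] (B : Matrix m m R)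
    (l : m → L) (hB : ∀ i j, l i ≠ l j → B i j = 0) :
    B.det = ∏ a ∈ Finset.univ.image l, (B.toSquareBlock l a).det := by
  classical
  -- The order is arbitrary: a block diagonal matrix is block triangular for any order of the
  -- labels.
  let _ : LinearOrder L := linearOrderOfSTO WellOrderingRel
  have h : B.BlockTriangular l := fun i j hij => hB i j hij.ne'
  convert h.det

end Determinants

/-! ### Lattice points in generic position -/

section Lattice

variable {M : Type*} [AddCommGroup M]

theorem repr_emb {κ : Type*} (B : Module.Basis κ ℤ M) (b : M) (j : κ) :
    (B.baseChange ℝ).repr (emb M b) j = (B.repr b j : ℝ) := by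
  change (B.baseChange ℝ).repr ((1 : ℝ) ⊗ₜ[ℤ] b) j = _
  simp

variable {n : ℕ} {A : Fin (n + 1) → Finset M} {ρ ψ : Fin (n + 1) → ℝ ⊗[ℤ] M → ℝ} {δ : ℝ ⊗[ℤ] M}

/-- `(i, a)` is the pivot of the cell in the direction `w`: `i` is the largest index such that the
`i`-th component of the cell is a point, and `a ∈ A i` is that point. -/
def IsPivot (A : Fin (n + 1) → Finset M) (ρ : Fin (n + 1) → ℝ ⊗[ℤ] M → ℝ)
    (w : Module.Dual ℝ (ℝ ⊗[ℤ] M)) (p : Fin (n + 1) × M) : Prop :=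
  IsGreatest {i | dim (cell (newton (A i)) (ρ i) w) = 0} p.1 ∧ p.2 ∈ A p.1 ∧
    cell (newton (A p.1)) (ρ p.1) w = {emb M p.2}

/-- The position of a lattice point `b` in the mixed subdivisions by `ρ` and by the coarser `ψ`:
`b - δ` is the sum of the points `y i` of the components of the `ρ`-cell in the direction `w`, which
are contained in those of the `ψ`-cell in the direction `v`, and `p` is the pivot of the
`ρ`-cell. -/
structure IsPosition (A : Fin (n + 1) → Finset M) (ρ ψ : Fin (n + 1) → ℝ ⊗[ℤ] M → ℝ)
    (δ : ℝ ⊗[ℤ] M) (b : M) (y : Fin (n + 1) → ℝ ⊗[ℤ] M) (w v : Module.Dual ℝ (ℝ ⊗[ℤ] M))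
    (p : Fin (n + 1) × M) : Prop where
  mem : ∀ i, y i ∈ cell (newton (A i)) (ρ i) w
  sum : ∑ i, y i = emb M b - δ
  sub : ∀ i, cell (newton (A i)) (ρ i) w ⊆ cell (newton (A i)) (ψ i) v
  pivot : IsPivot A ρ w p

theorem component_eq_of_isPosition (hψ : ∀ i, BddBelow (ψ i '' newton (A i))) {b : M}
    {y : Fin (n + 1) → ℝ ⊗[ℤ] M} {w v : Module.Dual ℝ (ℝ ⊗[ℤ] M)} {p : Fin (n + 1) × M}
    (hpos : IsPosition A ρ ψ δ b y w v p) (i : Fin (n + 1)) :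
    component (fun i => newton (A i)) ψ
      (cell (∑ i, newton (A i)) (infConv (fun i => newton (A i)) ψ) v) i =
      cell (newton (A i)) (ψ i) v :=
  component_eq_cell hψ (fun i => ⟨y i, hpos.sub i (hpos.mem i)⟩) i

theorem mem_cell_of_isPosition {b : M}
    {y : Fin (n + 1) → ℝ ⊗[ℤ] M} {w v : Module.Dual ℝ (ℝ ⊗[ℤ] M)} {p : Fin (n + 1) × M}
    (hpos : IsPosition A ρ ψ δ b y w v p) :
    emb M b - δ ∈ cell (∑ i, newton (A i)) (infConv (fun i => newton (A i)) ψ) v := by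
  rw [← hpos.sum]
  exact sum_mem_cell fun i => hpos.sub i (hpos.mem i)

open Classical in
theorem matrix_apply (A : Fin (n + 1) → Finset M) (Λ : Fin (n + 1) → Set (ℝ ⊗[ℤ] M))
    {b : M} {p : Fin (n + 1) × M} (hp : rowContent A Λ ρ δ b = p) (b' : M) :
    matrix A Λ ρ δ b b' =
      if b' - b + p.2 ∈ A p.1 then MvPolynomial.X (p.1, b' - b + p.2) else 0 := by
  rw [matrix, hp, sylvester, Finset.sum_eq_single p.1]
  · rw [Pi.single_eq_same, laurent, Finset.mul_sum, AddMonoidAlgebra.coeff_sum,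
      Finsupp.finsetSum_apply]
    have : ∀ a, (AddMonoidAlgebra.single (b - p.2) 1 *
        AddMonoidAlgebra.single a (MvPolynomial.X (p.1, a)) :
          AddMonoidAlgebra (MvPolynomial (Fin (n + 1) × M) ℂ) M).coeff b' =
        if a = b' - b + p.2 then MvPolynomial.X (p.1, a) else 0 := fun a => by
      rw [AddMonoidAlgebra.single_mul_single, one_mul, AddMonoidAlgebra.coeff_single,
        Finsupp.single_apply]
      refine if_congr ⟨fun h => ?_, fun h => ?_⟩ rfl rfl
      · rw [← h]
        abel
      · rw [h]
        abel
    rw [Finset.sum_congr rfl fun a _ => this a, Finset.sum_ite_eq']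
  · intro i _ hi
    rw [Pi.single_eq_of_ne hi, zero_mul]
  · simp

section Finite

variable [Module.Finite ℤ M]

theorem dim_mono {C C' : Set (ℝ ⊗[ℤ] M)} (h : C ⊆ C') : dim C ≤ dim C' :=
  Submodule.finrank_mono (vectorSpan_mono ℝ h)

end Finite

variable [Module.Free ℤ M]

theorem emb_injective : Function.Injective (emb M) := by
  let B := Module.Free.chooseBasis ℤ M
  intro a b hab
  apply B.repr.injective
  ext i
  have h := congrArg (fun x => (B.baseChange ℝ).repr x i) hab
  simpa only [repr_emb, Int.cast_inj] using h

theorem finrank_real : Module.finrank ℝ (ℝ ⊗[ℤ] M) = Module.finrank ℤ M :=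
  Module.finrank_baseChange

variable [Module.Finite ℤ M]

theorem indexSet_finite (hA : ∀ i, (A i).Nonempty) (δ : ℝ ⊗[ℤ] M) :
    (indexSet (fun i => newton (A i)) δ).Finite := by
  let B := Module.Free.chooseBasis ℤ M
  have hbd : ∀ l : Module.Dual ℝ (ℝ ⊗[ℤ] M), ∃ c, ∀ x ∈ ∑ i, newton (A i), c ≤ l x := by
    intro l
    choose c hc using fun i => bddBelow_linear_newton (hA i) l
    refine ⟨∑ i, c i, fun x hx => ?_⟩
    obtain ⟨y, hy, rfl⟩ := mem_sum_iff.1 hx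
    rw [map_sum]
    exact Finset.sum_le_sum fun i _ => hc i _ (hy i)
  choose c hc using fun j => hbd ((B.baseChange ℝ).coord j)
  choose c' hc' using fun j => hbd (-(B.baseChange ℝ).coord j)
  have hcoord : ∀ j b, (B.baseChange ℝ).coord j (emb M b) = (B.repr b j : ℝ) := fun j b => by
    rw [Module.Basis.coord_apply, repr_emb]
  refine Set.Finite.of_finite_image (f := fun b j => B.repr b j) ?_ fun a _ b _ hab => ?_
  · refine (Set.finite_Icc (fun j => ⌈c j + (B.baseChange ℝ).coord j δ⌉)
      (fun j => ⌊(B.baseChange ℝ).coord j δ - c' j⌋)).subset ?_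
    rintro _ ⟨b, hb, rfl⟩
    refine ⟨fun j => Int.ceil_le.2 ?_, fun j => Int.le_floor.2 ?_⟩
    · have := hc j _ hb
      rw [map_sub, hcoord] at this
      linarith
    · have := hc' j _ hb
      rw [LinearMap.neg_apply, map_sub, hcoord] at this
      linarith
  · exact B.repr.injective (DFunLike.coe_injective hab)

theorem dim_le (hn : Module.finrank ℤ M = n) (C : Set (ℝ ⊗[ℤ] M)) : dim C ≤ n := by
  rw [← hn, ← finrank_real]
  exact Submodule.finrank_le _

variable {ν : Fin (n + 1) → M → ℝ}

/-- If `u` were nonzero, perturbing `w` along `u` would give a cell containing `b - δ` on which `u`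
is constant. Its directions lie in `ker u`, so its dimension is below `n`, against genericity. -/
theorem eq_zero_of_isGeneric (hn : Module.finrank ℤ M = n) (hA : ∀ i, (A i).Nonempty)
    (hρ : ∀ i, Set.EqOn (ρ i) (lowerEnvelope (A i) (ν i)) (newton (A i)))
    (hδ : IsGeneric (fun i => newton (A i)) ρ δ) {b : M} {w u : Module.Dual ℝ (ℝ ⊗[ℤ] M)}
    {y : Fin (n + 1) → ℝ ⊗[ℤ] M} (hy : ∀ i, y i ∈ cell (newton (A i)) (ρ i) w)
    (hyb : ∑ i, y i = emb M b - δ)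
    (hu : ∀ i, ∀ z ∈ cell (newton (A i)) (ρ i) w, u (y i) ≤ u z) : u = 0 := by
  by_contra hu0
  obtain ⟨w', hw'⟩ := exists_perturbation hA hρ hy hu
  set C := cell (∑ i, newton (A i)) (infConv (fun i => newton (A i)) ρ) w' with hC
  refine hδ C ⟨w', rfl⟩ ?_ b (hyb ▸ sum_mem_cell fun i => (hw' i).1)
  have hconst : ∀ x ∈ C, u x = ∑ i, u (y i) := by
    intro x hx
    obtain ⟨w'', z, hz, rfl⟩ := exists_mem_cell_envelope hA hρ (mem_cell.1 hx).1
    rw [map_sum]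
    exact Finset.sum_congr rfl fun i _ => (hw' i).2 _
      (mem_cell_of_sum_mem_cell (fun i => bddBelow_envelope (hA i) (hρ i))
        (fun i => (mem_cell.1 (hz i)).1) hx (infConv_eq_sum hz) i)
  have hle : vectorSpan ℝ C ≤ LinearMap.ker u := by
    refine Submodule.span_le.2 ?_
    rintro _ ⟨x, hx, x', hx', rfl⟩
    simp [hconst x hx, hconst x' hx']
  have hlt : Module.finrank ℝ (LinearMap.ker u) < Module.finrank ℝ (ℝ ⊗[ℤ] M) :=
    Submodule.finrank_lt fun h => hu0 (LinearMap.ker_eq_top.1 h)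
  rw [finrank_real, hn] at hlt
  exact (Submodule.finrank_mono hle).trans_lt hlt

theorem exists_isPivot
    (hA : ∀ i, (A i).Nonempty)
    (hρ : ∀ i, Set.EqOn (ρ i) (lowerEnvelope (A i) (ν i)) (newton (A i)))
    {w : Module.Dual ℝ (ℝ ⊗[ℤ] M)} (hw : ∑ i, dim (cell (newton (A i)) (ρ i) w) = n) :
    ∃ p, IsPivot A ρ w p := by
  classical
  -- There are `n + 1` dimensions with sum `n`.
  obtain ⟨i₀, hi₀⟩ : ∃ i, dim (cell (newton (A i)) (ρ i) w) = 0 := by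
    by_contra hcon
    push Not at hcon
    have : ∑ _i : Fin (n + 1), 1 ≤ ∑ i, dim (cell (newton (A i)) (ρ i) w) :=
      Finset.sum_le_sum fun i _ => Nat.one_le_iff_ne_zero.2 (hcon i)
    simp [hw] at this
  obtain ⟨i, hi, hmax⟩ := Finset.exists_max_image
    (Finset.univ.filter fun i => dim (cell (newton (A i)) (ρ i) w) = 0) id ⟨i₀, by simpa using hi₀⟩
  have hi : dim (cell (newton (A i)) (ρ i) w) = 0 := by simpa using hi
  obtain ⟨a, ha, hac⟩ := cell_envelope_nonempty (hA i) (hρ i) w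
  refine ⟨(i, a), ⟨hi, fun j hj => hmax j (by simpa using hj)⟩, ha, ?_⟩
  have hss : (cell (newton (A i)) (ρ i) w).Subsingleton := by
    rw [← vectorSpan_eq_bot_iff_subsingleton ℝ]
    exact Submodule.finrank_eq_zero.1 hi
  exact hss.eq_singleton_of_mem hac

theorem dim_cell_eq (hn : Module.finrank ℤ M = n)
    (hδ : IsGeneric (fun i => newton (A i)) ρ δ) {b : M} {w : Module.Dual ℝ (ℝ ⊗[ℤ] M)}
    {y : Fin (n + 1) → ℝ ⊗[ℤ] M} (hy : ∀ i, y i ∈ cell (newton (A i)) (ρ i) w)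
    (hyb : ∑ i, y i = emb M b - δ) :
    dim (cell (∑ i, newton (A i)) (infConv (fun i => newton (A i)) ρ) w) = n := by
  by_contra hcon
  exact hδ _ ⟨w, rfl⟩ (lt_of_le_of_ne (dim_le hn _) hcon) b (hyb ▸ sum_mem_cell hy)

theorem exists_isPosition (hn : Module.finrank ℤ M = n) (hA : ∀ i, (A i).Nonempty)
    (hρ : ∀ i, Set.EqOn (ρ i) (lowerEnvelope (A i) (ν i)) (newton (A i)))
    (htight : IsTight (fun i => newton (A i)) ρ n)
    (hδ : IsGeneric (fun i => newton (A i)) ρ δ)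
    (hψ : ∀ i, BddBelow (ψ i '' newton (A i)))
    (hψρ : IsCoarser (fun i => newton (A i)) ψ ρ) {b : M}
    (hb : b ∈ indexSet (fun i => newton (A i)) δ) :
    ∃ y w v p, IsPosition A ρ ψ δ b y w v p := by
  have hρb := fun i => bddBelow_envelope (hA i) (hρ i)
  obtain ⟨w, y, hy, hyb⟩ := exists_mem_cell_envelope hA hρ hb
  obtain ⟨_, ⟨v, rfl⟩, -, hv⟩ := hψρ _ ⟨w, rfl⟩
  have hcomp := component_eq_cell hρb (fun i => ⟨y i, hy i⟩)
  have ht := htight _ ⟨⟨w, rfl⟩, dim_cell_eq hn hδ hy hyb⟩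
  simp only [hcomp] at ht hv
  obtain ⟨p, hp⟩ := exists_isPivot hA hρ ht
  exact ⟨y, w, v, p, hy, hyb, fun i => (hv i).trans (component_subset_cell hψ i), hp⟩

/-- Row contents are defined by choice, but genericity leaves only one direction whose cell contains
`b - δ`. The polytopes `Λ` may be the original ones or the components of a coarse cell; genericity
is used only for the original family. -/
theorem rowContent_eq (hn : Module.finrank ℤ M = n) (hA : ∀ i, (A i).Nonempty)
    (hρ : ∀ i, Set.EqOn (ρ i) (lowerEnvelope (A i) (ν i)) (newton (A i)))
    (hδ : IsGeneric (fun i => newton (A i)) ρ δ) {b : M} {w v : Module.Dual ℝ (ℝ ⊗[ℤ] M)}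
    {y : Fin (n + 1) → ℝ ⊗[ℤ] M} {p : Fin (n + 1) × M} (hpos : IsPosition A ρ ψ δ b y w v p)
    {Λ : Fin (n + 1) → Set (ℝ ⊗[ℤ] M)} (hΛ : ∀ i, Λ i ⊆ newton (A i))
    (hwΛ : ∀ i, cell (newton (A i)) (ρ i) w ⊆ Λ i) {A' : Fin (n + 1) → Finset M}
    (hpA : p.2 ∈ A' p.1) : rowContent A' Λ ρ δ b = p := by
  obtain ⟨hy, hyb, -, hp⟩ := hpos
  have hb : ∀ i, BddBelow (ρ i '' Λ i) := fun i =>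
    (bddBelow_envelope (hA i) (hρ i)).mono (Set.image_mono (hΛ i))
  have hcell : ∀ i, cell (Λ i) (ρ i) w = cell (newton (A i)) (ρ i) w := fun i =>
    cell_eq_of_subset ⟨y i, hy i⟩ (hwΛ i) (hΛ i)
  have hyΛ : ∀ i, y i ∈ cell (Λ i) (ρ i) w := fun i => (hcell i).symm ▸ hy i
  have hcomp : ∀ i, component Λ ρ (cell (∑ i, Λ i) (infConv Λ ρ) w) i =
      cell (newton (A i)) (ρ i) w := fun i => by
    rw [component_eq_cell hb (fun i => ⟨y i, hyΛ i⟩), hcell]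
  have hdim : dim (cell (∑ i, Λ i) (infConv Λ ρ) w) = n := by
    refine le_antisymm (dim_le hn _) ?_
    conv_lhs => rw [← dim_cell_eq hn hδ hy hyb]
    refine dim_mono fun x hx => ?_
    obtain ⟨w'', z, hz, rfl⟩ := exists_mem_cell_envelope hA hρ (mem_cell.1 hx).1
    refine sum_mem_cell fun i => ?_
    rw [hcell]
    exact mem_cell_of_sum_mem_cell (fun i => bddBelow_envelope (hA i) (hρ i))
      (fun i => (mem_cell.1 (hz i)).1) hx (infConv_eq_sum hz) i
  have hex : ∃ q, IsRowContent A' Λ ρ δ b q := by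
    refine ⟨p, _, ⟨⟨w, rfl⟩, hdim⟩, hyb ▸ sum_mem_cell hyΛ, ?_, hpA, ?_⟩
    · simpa only [hcomp] using hp.1
    · rw [hcomp]
      exact hp.2.2
  rw [rowContent, dif_pos hex]
  obtain ⟨E, ⟨⟨w', rfl⟩, -⟩, hbE, hq1, hq2, hq3⟩ := hex.choose_spec
  set q := hex.choose
  have hyw' : ∀ i, y i ∈ cell (Λ i) (ρ i) w' :=
    mem_cell_of_sum_mem_cell hb (fun i => (mem_cell.1 (hyΛ i)).1) (hyb.symm ▸ hbE)
      (infConv_eq_sum hyΛ)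
  -- On the `i`-th component for `w` the sum `ρ i + w` is constant, while `y i` minimizes `ρ i +
  -- w'`; hence `y i` minimizes the difference `w' - w`.
  have hww' : w' - w = 0 := by
    refine eq_zero_of_isGeneric hn hA hρ hδ hy hyb fun i z hz => ?_
    have h1 := (mem_cell.1 (hyw' i)).2 z (hwΛ i hz)
    have h2 := (mem_cell.1 hz).2 (y i) (mem_cell.1 (hy i)).1
    simp only [LinearMap.sub_apply]
    linarith
  obtain rfl : w' = w := sub_eq_zero.1 hww'
  simp only [hcomp] at hq1 hq3
  have h1 : q.1 = p.1 := hq1.unique hp.1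
  rw [h1, hp.2.2] at hq3
  exact Prod.ext h1 (emb_injective (Set.singleton_injective hq3)).symm

/-- The functional `v' - v` is minimized at each `y i`, so it vanishes by genericity. The pivot
index needs no assumption because its `ρ`-component is a single point; this is what tolerates the
exchange of that summand. -/
theorem direction_unique (hn : Module.finrank ℤ M = n) (hA : ∀ i, (A i).Nonempty)
    (hρ : ∀ i, Set.EqOn (ρ i) (lowerEnvelope (A i) (ν i)) (newton (A i)))
    (hδ : IsGeneric (fun i => newton (A i)) ρ δ) {b : M} {w v v' : Module.Dual ℝ (ℝ ⊗[ℤ] M)}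
    {y : Fin (n + 1) → ℝ ⊗[ℤ] M} {p : Fin (n + 1) × M} (hpos : IsPosition A ρ ψ δ b y w v p)
    (hy : ∀ i, i ≠ p.1 → y i ∈ cell (newton (A i)) (ψ i) v') : v' = v := by
  refine sub_eq_zero.1 (eq_zero_of_isGeneric hn hA hρ hδ hpos.mem hpos.sum fun i z hz => ?_)
  by_cases hi : i = p.1
  · subst hi
    have h1 := hpos.mem p.1
    rw [hpos.pivot.2.2] at h1 hz
    rw [h1, hz]
  · have h1 := (mem_cell.1 (hy i hi)).2 z (mem_cell.1 hz).1
    have h2 := (mem_cell.1 (hpos.sub i hz)).2 (y i) (mem_cell.1 (hpos.mem i)).1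
    simp only [LinearMap.sub_apply]
    linarith

theorem direction_eq_of_mem_cell (hn : Module.finrank ℤ M = n) (hA : ∀ i, (A i).Nonempty)
    (hρ : ∀ i, Set.EqOn (ρ i) (lowerEnvelope (A i) (ν i)) (newton (A i)))
    (hδ : IsGeneric (fun i => newton (A i)) ρ δ) (hψ : ∀ i, BddBelow (ψ i '' newton (A i)))
    {b : M} {w v v' : Module.Dual ℝ (ℝ ⊗[ℤ] M)} {y : Fin (n + 1) → ℝ ⊗[ℤ] M}
    {p : Fin (n + 1) × M} (hpos : IsPosition A ρ ψ δ b y w v p)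
    (hb : emb M b - δ ∈ cell (∑ i, newton (A i)) (infConv (fun i => newton (A i)) ψ) v') :
    v' = v :=
  direction_unique hn hA hρ hδ hpos fun i _ =>
    mem_cell_of_sum_mem_cell hψ (fun i => (mem_cell.1 (hpos.mem i)).1) (hpos.sum.symm ▸ hb)
      (infConv_eq_sum fun i => hpos.sub i (hpos.mem i)) i

/-- The excess of a nonzero entry at `(b, b')` of the Canny-Emiris matrix is nonnegative; it vanishes
exactly for the monomials in the component of the cell of `b`, and then `b'` lies in that cell. -/
theorem excess_nonneg_and_eq_zero_iff (hn : Module.finrank ℤ M = n) (hA : ∀ i, (A i).Nonempty)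
    (hρ : ∀ i, Set.EqOn (ρ i) (lowerEnvelope (A i) (ν i)) (newton (A i)))
    (hδ : IsGeneric (fun i => newton (A i)) ρ δ) (hψ : ∀ i, BddBelow (ψ i '' newton (A i)))
    {b b' : M} {w v w' v' : Module.Dual ℝ (ℝ ⊗[ℤ] M)} {y y' : Fin (n + 1) → ℝ ⊗[ℤ] M}
    {p p' : Fin (n + 1) × M} (hpos : IsPosition A ρ ψ δ b y w v p)
    (hpos' : IsPosition A ρ ψ δ b' y' w' v' p') (hq : b' - b + p.2 ∈ A p.1) {d : ℝ}
    (hd : d = ψ p.1 (emb M (b' - b + p.2)) - ψ p.1 (emb M p.2) -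
      (infConv (fun i => newton (A i)) ψ (emb M b' - δ) -
        infConv (fun i => newton (A i)) ψ (emb M b - δ))) :
    0 ≤ d ∧ (d = 0 ↔ emb M (b' - b + p.2) ∈ cell (newton (A p.1)) (ψ p.1) v) ∧
      (d = 0 → v' = v) := by
  classical
  set q := b' - b + p.2 with hqdef
  have hyp : y p.1 = emb M p.2 := by
    have := hpos.mem p.1
    rwa [hpos.pivot.2.2] at this
  have hyψ := fun i => hpos.sub i (hpos.mem i)
  set z := Function.update y p.1 (emb M q) with hz
  have hzsum : ∑ i, z i = emb M b' - δ := by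
    have h : ∑ j, z j = ∑ j, y j - y p.1 + emb M q := sum_apply_update (fun _ x => x) y p.1 _
    rw [h, hpos.sum, hyp, hqdef, map_add, map_sub]
    abel
  have hzψ : ∑ i, ψ i (z i) = ∑ i, ψ i (y i) - ψ p.1 (y p.1) + ψ p.1 (emb M q) :=
    sum_apply_update ψ y p.1 _
  have hzmem : ∀ i, z i ∈ newton (A i) := fun i => by
    by_cases h : i = p.1
    · subst h
      simpa [hz] using emb_mem_newton hq
    · simpa [hz, h] using (mem_cell.1 (hyψ i)).1
  have hle := infConv_le hψ hzmem
  have hby := infConv_eq_sum hyψ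
  rw [hpos.sum] at hby
  -- The excess is the failure of optimality of the exchanged decomposition `z` of `b' - δ`.
  have hd' : d = ∑ i, ψ i (z i) - infConv (fun i => newton (A i)) ψ (∑ i, z i) := by
    rw [hd, hzψ, hzsum, hby, hyp]
    ring
  have hdv : d = 0 → v' = v ∧ ∀ i, z i ∈ cell (newton (A i)) (ψ i) v' := by
    intro h0
    have hmem := mem_cell_of_sum_mem_cell (v := v') hψ hzmem
      (by rw [hzsum, ← hpos'.sum]; exact sum_mem_cell fun i => hpos'.sub i (hpos'.mem i))
      (by linarith)
    refine ⟨direction_unique hn hA hρ hδ hpos fun i hi => ?_, hmem⟩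
    simpa [hz, hi] using hmem i
  refine ⟨by linarith, ⟨fun h0 => ?_, fun hmem => ?_⟩, fun h0 => (hdv h0).1⟩
  · obtain ⟨hvv, hmem⟩ := hdv h0
    have := hmem p.1
    rw [hvv] at this
    simpa [hz] using this
  · have hzcell : ∀ i, z i ∈ cell (newton (A i)) (ψ i) v := fun i => by
      by_cases h : i = p.1
      · subst h
        simpa [hz] using hmem
      · simpa [hz, h] using hyψ i
    rw [hd', infConv_eq_sum hzcell, sub_self]

end Lattice

/-! ### Initial parts of Canny-Emiris minors -/

section Main

variable {M : Type*} [AddCommGroup M] [Module.Free ℤ M] [Module.Finite ℤ M] {n : ℕ}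
  {A : Fin (n + 1) → Finset M} {ν : Fin (n + 1) → M → ℝ} {ρ φ : Fin (n + 1) → ℝ ⊗[ℤ] M → ℝ}
  {δ : ℝ ⊗[ℤ] M}

theorem dim_coarse_cell (hn : Module.finrank ℤ M = n) (hA : ∀ i, (A i).Nonempty)
    (hρ : ∀ i, Set.EqOn (ρ i) (lowerEnvelope (A i) (ν i)) (newton (A i)))
    (hδ : IsGeneric (fun i => newton (A i)) ρ δ) {b : M}
    {y : Fin (n + 1) → ℝ ⊗[ℤ] M} {w v : Module.Dual ℝ (ℝ ⊗[ℤ] M)} {p : Fin (n + 1) × M}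
    (hpos : IsPosition A ρ φ δ b y w v p) :
    dim (cell (∑ i, newton (A i)) (infConv (fun i => newton (A i)) φ) v) = n := by
  refine le_antisymm (dim_le hn _) ?_
  conv_lhs => rw [← dim_cell_eq hn hδ hpos.mem hpos.sum]
  refine dim_mono fun x hx => ?_
  obtain ⟨w', z, hz, rfl⟩ := exists_mem_cell_envelope hA hρ (mem_cell.1 hx).1
  exact sum_mem_cell fun i => hpos.sub i
    (mem_cell_of_sum_mem_cell (fun i => bddBelow_envelope (hA i) (hρ i))
      (fun i => (mem_cell.1 (hz i)).1) hx (infConv_eq_sum hz) i)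

open Classical in
theorem ord_init_minor (hn : Module.finrank ℤ M = n) (hA : ∀ i, (A i).Nonempty)
    (hρ : ∀ i, Set.EqOn (ρ i) (lowerEnvelope (A i) (ν i)) (newton (A i)))
    (htight : IsTight (fun i => newton (A i)) ρ n)
    (hδ : IsGeneric (fun i => newton (A i)) ρ δ)
    (hφ : ∀ i, BddBelow (φ i '' newton (A i)))
    (hφρ : IsCoarser (fun i => newton (A i)) φ ρ)
    (ω : Fin (n + 1) × M → ℝ) (hω : ∀ i, ∀ a ∈ A i, ω (i, a) = φ i (emb M a))
    (C : Finset M) (hC : (C : Set M) ⊆ indexSet (fun i => newton (A i)) δ) :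
    ord ω (minor A (fun i => newton (A i)) ρ δ C) =
        ((∑ b ∈ C, φ (rowContent A (fun i => newton (A i)) ρ δ b).1
          (emb M (rowContent A (fun i => newton (A i)) ρ δ b).2) : ℝ) : WithTop ℝ) ∧
      init ω (minor A (fun i => newton (A i)) ρ δ C) =
        ∏ᶠ D ∈ mixedCellsOfDim (fun i => newton (A i)) φ n,
          minor (restrictSupp A (component (fun i => newton (A i)) φ D))
            (component (fun i => newton (A i)) φ D) ρ δ (restrictIndex C D δ) := by
  have hρb := fun i => bddBelow_envelope (hA i) (hρ i)
  choose y w v p hpos using fun b : C =>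
    exists_isPosition hn hA hρ htight hδ hφ hφρ (hC b.2)
  -- Taking `ρ` as a coarsening of itself makes the excess estimate available for the nonvanishing
  -- argument.
  have hposρ : ∀ b : C, IsPosition A ρ ρ δ b (y b) (w b) (w b) (p b) := fun b =>
    ⟨(hpos b).mem, (hpos b).sum, fun _ => subset_rfl, (hpos b).pivot⟩
  have hrow : ∀ b : C, rowContent A (fun i => newton (A i)) ρ δ b = p b := fun b =>
    rowContent_eq hn hA hρ hδ (hpos b) (fun _ => subset_rfl) (fun _ => cell_subset _ _ _)
      (hpos b).pivot.2.1
  set q : C → C → M := fun b b' => (b' : M) - b + (p b).2 with hq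
  let P : Matrix C C (MvPolynomial (Fin (n + 1) × M) ℂ) :=
    (matrix A (fun i => newton (A i)) ρ δ).submatrix (fun b : C => (b : M)) (fun b : C => (b : M))
  have hP : ∀ b b', P b b' =
      if q b b' ∈ A (p b).1 then MvPolynomial.X ((p b).1, q b b') else 0 := fun b b' =>
    matrix_apply A _ (hrow b) b'
  set exc : (Fin (n + 1) → ℝ ⊗[ℤ] M → ℝ) → (Fin (n + 1) × M → ℝ) → C → C → ℝ :=
    fun ψ η b b' => η ((p b).1, q b b') - ψ (p b).1 (emb M (p b).2) -
      (infConv (fun i => newton (A i)) ψ (emb M b' - δ) -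
        infConv (fun i => newton (A i)) ψ (emb M b - δ)) with hexc
  have hexcφ : ∀ b b' : C, q b b' ∈ A (p b).1 → 0 ≤ exc φ ω b b' ∧
      (exc φ ω b b' = 0 ↔ emb M (q b b') ∈ cell (newton (A (p b).1)) (φ (p b).1) (v b)) ∧
      (exc φ ω b b' = 0 → v b' = v b) := fun b b' hqA =>
    excess_nonneg_and_eq_zero_iff hn hA hρ hδ hφ (hpos b) (hpos b') hqA (by rw [hexc, ← hω _ _ hqA])
  set η : Fin (n + 1) × M → ℝ := fun s => ρ s.1 (emb M s.2) with hη
  have hexcρ : ∀ b b' : C, q b b' ∈ A (p b).1 → 0 ≤ exc ρ η b b' ∧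
      (exc ρ η b b' = 0 ↔ emb M (q b b') ∈ cell (newton (A (p b).1)) (ρ (p b).1) (w b)) ∧
      (exc ρ η b b' = 0 → w b' = w b) := fun b b' hqA =>
    excess_nonneg_and_eq_zero_iff hn hA hρ hδ hρb (hposρ b) (hposρ b') hqA rfl
  set B := tightPart P (exc φ ω) with hB
  have hBapply : ∀ b b', B b b' =
      if q b b' ∈ A (p b).1 ∧ emb M (q b b') ∈ cell (newton (A (p b).1)) (φ (p b).1) (v b)
      then MvPolynomial.X ((p b).1, q b b') else 0 := by
    intro b b'
    rw [hB, tightPart, hP]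
    by_cases hqA : q b b' ∈ A (p b).1
    · simp only [hqA, true_and, if_true]
      exact if_congr (hexcφ b b' hqA).2.1 rfl rfl
    · simp [hqA]
  have hqself : ∀ b, q b b = (p b).2 := fun b => by simp [hq]
  -- the tight part of `B` for `ρ` is diagonal
  have hBne : B.det ≠ 0 := by
    have hdiag : tightPart B (exc ρ η) = Matrix.diagonal fun b => MvPolynomial.X (p b) := by
      ext1 b b'
      rw [tightPart, hBapply]
      by_cases hbb : b = b'
      · subst hbb
        have hqA : q b b ∈ A (p b).1 := by
          rw [hqself]
          exact (hpos b).pivot.2.1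
        have hmem : emb M (q b b) ∈ cell (newton (A (p b).1)) (ρ (p b).1) (w b) := by
          rw [hqself, (hpos b).pivot.2.2]
          rfl
        rw [if_pos ((hexcρ b b hqA).2.1.2 hmem), if_pos ⟨hqA, (hpos b).sub _ hmem⟩,
          Matrix.diagonal_apply_eq, hqself]
      · rw [Matrix.diagonal_apply_ne _ hbb]
        split_ifs with h1 h2
        · have h3 := (hexcρ b b' h2.1).2.1.1 h1
          rw [(hpos b).pivot.2.2] at h3
          have h4 : q b b' = (p b).2 := emb_injective h3
          refine absurd (Subtype.ext ?_) hbb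
          rw [hq] at h4
          exact (sub_eq_zero.1 (add_eq_right.1 h4)).symm
        · rfl
        · rfl
    have hcoeff := (det_coeffs (ω := η) (P := B) (d := exc ρ η)
      (e := fun b b' => η ((p b).1, q b b')) (f := fun b => ρ (p b).1 (emb M (p b).2))
      (g := fun b => infConv (fun i => newton (A i)) ρ (emb M b - δ)) (fun b b' => by
        rw [hBapply]
        split_ifs
        · exact weighted_X _ _
        · rw [weighted_zero, AddMonoidAlgebra.single_zero]) (fun b b' hne => by
        refine (hexcρ b b' ?_).1
        by_contra hqA
        exact hne (by rw [hBapply, if_neg fun h => hqA h.1])) (fun b b' => by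
        rw [hexc]
        ring)).1
    -- The `η`-weighted determinant of `B` has a product of variables as a coefficient, which is
    -- impossible if the determinant vanishes.
    intro h0
    rw [h0, weighted_zero, hdiag, Matrix.det_diagonal] at hcoeff
    exact Finset.prod_ne_zero_iff.2 (fun b _ => MvPolynomial.X_ne_zero (p b)) hcoeff.symm
  have hPcoeff := det_coeffs (ω := ω) (P := P) (d := exc φ ω)
    (e := fun b b' => ω ((p b).1, q b b')) (f := fun b => φ (p b).1 (emb M (p b).2))
    (g := fun b => infConv (fun i => newton (A i)) φ (emb M b - δ)) (fun b b' => by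
      rw [hP]
      split_ifs
      · exact weighted_X _ _
      · rw [weighted_zero, AddMonoidAlgebra.single_zero]) (fun b b' hne => by
      refine (hexcφ b b' ?_).1
      by_contra hqA
      exact hne (by rw [hP, if_neg hqA])) (fun b b' => by
      rw [hexc]
      ring)
  obtain ⟨hord, hinit⟩ := ord_init_eq hPcoeff.1 hBne hPcoeff.2
  have hminor : minor A (fun i => newton (A i)) ρ δ C = P.det := rfl
  rw [hminor, hord, hinit]
  refine ⟨?_, ?_⟩
  · rw [← Finset.sum_coe_sort C]
    simp only [hrow]
  set l : C → Set (ℝ ⊗[ℤ] M) := fun b =>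
    cell (∑ i, newton (A i)) (infConv (fun i => newton (A i)) φ) (v b) with hl
  have hlmem : ∀ b : C, l b ∈ mixedCellsOfDim (fun i => newton (A i)) φ n := fun b =>
    ⟨⟨v b, rfl⟩, dim_coarse_cell hn hA hρ hδ (hpos b)⟩
  have hluniq : ∀ D ∈ mixedCellsOfDim (fun i => newton (A i)) φ n, ∀ b : C,
      emb M b - δ ∈ D → l b = D := by
    rintro _ ⟨⟨v', rfl⟩, -⟩ b hb
    rw [hl, direction_eq_of_mem_cell hn hA hρ hδ hφ (hpos b) hb]
  have hcomp : ∀ b i, component (fun i => newton (A i)) φ (l b) i =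
      cell (newton (A i)) (φ i) (v b) := fun b i => component_eq_of_isPosition hφ (hpos b) i
  rw [det_eq_prod_blocks B l fun b b' hne => ?_]
  · rw [finprod_mem_eq_prod_of_inter_mulSupport_eq (t := Finset.univ.image l)]
    · refine Finset.prod_congr rfl fun D hD => ?_
      obtain ⟨b₀, -, rfl⟩ := Finset.mem_image.1 hD
      set D := l b₀ with hDdef
      -- Uniqueness of the direction identifies the points labelled `D` with those of `C` lying in
      -- `D + δ`.
      let ε : {b : C // l b = D} ≃ (restrictIndex C D δ : Finset M) :=
        { toFun := fun b => ⟨b.1, Finset.mem_filter.2 ⟨b.1.2, 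
            b.2.subset (mem_cell_of_isPosition (hpos b.1))⟩⟩
          invFun := fun b => ⟨⟨b.1, (Finset.mem_filter.1 b.2).1⟩,
            hluniq D (hlmem b₀) _ (Finset.mem_filter.1 b.2).2⟩
          left_inv := fun _ => rfl
          right_inv := fun _ => rfl }
      rw [minor, ← Matrix.det_submatrix_equiv_self ε]
      congr 1
      ext1 b b'
      have hcompD : ∀ i, component (fun i => newton (A i)) φ D i =
          cell (newton (A i)) (φ i) (v b.1) := fun i =>
        (congrArg (fun E => component (fun i => newton (A i)) φ E i) b.2.symm).trans (hcomp b.1 i)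
      have hpivot : emb M (p b.1).2 ∈ cell (newton (A (p b.1).1)) (φ (p b.1).1) (v b.1) :=
        (hpos b.1).sub _ (by rw [(hpos b.1).pivot.2.2]; rfl)
      have hrowD : rowContent (restrictSupp A (component (fun i => newton (A i)) φ D))
          (component (fun i => newton (A i)) φ D) ρ δ b.1 = p b.1 := by
        refine rowContent_eq hn hA hρ hδ (hpos b.1) (fun i => ?_) (fun i => ?_) ?_
        · rw [hcompD]
          exact cell_subset _ _ _
        · rw [hcompD]
          exact (hpos b.1).sub i
        · exact Finset.mem_filter.2 ⟨(hpos b.1).pivot.2.1, by rwa [hcompD]⟩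
      have h1 := matrix_apply (ρ := ρ) (δ := δ)
        (restrictSupp A (component (fun i => newton (A i)) φ D)) _ hrowD (b'.1 : M)
      refine Eq.trans ?_ h1.symm
      rw [Matrix.toSquareBlock_def, Matrix.of_apply, hBapply]
      refine if_congr ?_ rfl rfl
      rw [restrictSupp, Finset.mem_filter, hcompD]
    -- A cell `D` whose translate misses `C` contributes an empty determinant, equal to 1, so only
    -- the labels matter in the product.
    · ext D
      simp only [Set.mem_inter_iff, Finset.coe_image, Finset.coe_univ, Set.image_univ,
        and_congr_left_iff]
      intro hD
      refine ⟨fun hDn => ?_, ?_⟩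
      · have hne : (restrictIndex C D δ).Nonempty := by
          by_contra hcon
          rw [Finset.not_nonempty_iff_eq_empty] at hcon
          refine hD ?_
          have : IsEmpty (restrictIndex C D δ : Finset M) := Finset.isEmpty_coe_sort.2 hcon
          exact Matrix.det_isEmpty
        obtain ⟨b, hb⟩ := hne
        obtain ⟨hbC, hbD⟩ := Finset.mem_filter.1 hb
        exact ⟨⟨b, hbC⟩, hluniq D hDn _ hbD⟩
      · rintro ⟨b, rfl⟩
        exact hlmem b
  · rw [hB, tightPart]
    split_ifs with h0
    · rw [hP]
      split_ifs with hqA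
      · exact absurd (by simp only [hl, (hexcφ b b' hqA).2.2 h0]) hne
      · rfl
    · rfl

/-- For the full determinant, the points of the index set in `D + δ` must be the whole index set of
the restricted data. The optimal decomposition of such a point lies in the components of `D`, and
conversely sums from the components lie in `D`. -/
theorem restrictIndex_toFinset (hn : Module.finrank ℤ M = n) (hA : ∀ i, (A i).Nonempty)
    (hρ : ∀ i, Set.EqOn (ρ i) (lowerEnvelope (A i) (ν i)) (newton (A i)))
    (htight : IsTight (fun i => newton (A i)) ρ n)
    (hδ : IsGeneric (fun i => newton (A i)) ρ δ)
    (hφ : ∀ i, BddBelow (φ i '' newton (A i)))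
    (hφρ : IsCoarser (fun i => newton (A i)) φ ρ)
    (hfin : (indexSet (fun i => newton (A i)) δ).Finite) {D : Set (ℝ ⊗[ℤ] M)}
    (hD : D ∈ mixedCells (fun i => newton (A i)) φ) :
    (restrictIndex hfin.toFinset D δ : Set M) =
      indexSet (component (fun i => newton (A i)) φ D) δ := by
  classical
  obtain ⟨v', rfl⟩ := hD
  ext b
  rw [Finset.mem_coe]
  refine Finset.mem_filter.trans ?_
  rw [Set.Finite.mem_toFinset]
  constructor
  · rintro ⟨hb, hbD⟩
    obtain ⟨y, w, v, p, hpos⟩ := exists_isPosition hn hA hρ htight hδ hφ hφρ hb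
    obtain rfl := direction_eq_of_mem_cell hn hA hρ hδ hφ hpos hbD
    refine mem_sum_iff.2 ⟨y, fun i => ?_, hpos.sum⟩
    rw [component_eq_of_isPosition hφ hpos]
    exact hpos.sub i (hpos.mem i)
  · intro hb
    obtain ⟨y, hy, hyb⟩ := (mem_sum_iff (Λ := component (fun i => newton (A i)) φ _)).1 hb
    have hmem := sum_mem_cell fun i => component_subset_cell hφ i (hy i)
    rw [hyb] at hmem
    exact ⟨(mem_cell.1 hmem).1, hmem⟩

theorem determinant_component (hn : Module.finrank ℤ M = n) (hA : ∀ i, (A i).Nonempty)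
    (hρ : ∀ i, Set.EqOn (ρ i) (lowerEnvelope (A i) (ν i)) (newton (A i)))
    (htight : IsTight (fun i => newton (A i)) ρ n)
    (hδ : IsGeneric (fun i => newton (A i)) ρ δ)
    (hφ : ∀ i, BddBelow (φ i '' newton (A i)))
    (hφρ : IsCoarser (fun i => newton (A i)) φ ρ)
    (hfin : (indexSet (fun i => newton (A i)) δ).Finite) {D : Set (ℝ ⊗[ℤ] M)}
    (hD : D ∈ mixedCells (fun i => newton (A i)) φ) (A' : Fin (n + 1) → Finset M) :
    determinant A' (component (fun i => newton (A i)) φ D) ρ δ =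
      minor A' (component (fun i => newton (A i)) φ D) ρ δ
        (restrictIndex hfin.toFinset D δ) := by
  have h := restrictIndex_toFinset hn hA hρ htight hδ hφ hφρ hfin hD
  have hfin' : (indexSet (component (fun i => newton (A i)) φ D) δ).Finite :=
    h ▸ Finset.finite_toSet _
  rw [determinant, dif_pos hfin']
  congr 1
  apply Finset.coe_injective
  rw [h, Set.Finite.coe_toFinset]

end Main

end CannyEmiris

theorem theorem4 {M : Type*} [AddCommGroup M] [Module.Free ℤ M] [Module.Finite ℤ M]
    {n : ℕ} (hn : Module.finrank ℤ M = n)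
    (A : Fin (n + 1) → Finset M) (hA : ∀ i, (A i).Nonempty)
    (Δ : Fin (n + 1) → Set (ℝ ⊗[ℤ] M)) (hΔ : Δ = fun i => CannyEmiris.newton (A i))
    (ν : Fin (n + 1) → M → ℝ) (ρ : Fin (n + 1) → ℝ ⊗[ℤ] M → ℝ)
    (hρ : ∀ i, Set.EqOn (ρ i) (CannyEmiris.lowerEnvelope (A i) (ν i)) (Δ i))
    (htight : CannyEmiris.IsTight Δ ρ n)
    (δ : ℝ ⊗[ℤ] M) (hδ : CannyEmiris.IsGeneric Δ ρ δ)
    (φ : Fin (n + 1) → ℝ ⊗[ℤ] M → ℝ)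
    (hφ : ∀ i, CannyEmiris.IsConvexPiecewiseAffineOn (Δ i) (φ i))
    (hφρ : CannyEmiris.IsCoarser Δ φ ρ)
    (ω : Fin (n + 1) × M → ℝ) (hω : ∀ i, ∀ a ∈ A i, ω (i, a) = φ i (CannyEmiris.emb M a)) :
    (CannyEmiris.indexSet Δ δ).Finite ∧
    (∀ C : Finset M, (C : Set M) ⊆ CannyEmiris.indexSet Δ δ →
      CannyEmiris.ord ω (CannyEmiris.minor A Δ ρ δ C) =
        ((∑ b ∈ C, φ (CannyEmiris.rowContent A Δ ρ δ b).1
            (CannyEmiris.emb M (CannyEmiris.rowContent A Δ ρ δ b).2) : ℝ) : WithTop ℝ) ∧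
      CannyEmiris.init ω (CannyEmiris.minor A Δ ρ δ C) =
        ∏ᶠ D ∈ CannyEmiris.mixedCellsOfDim Δ φ n,
          CannyEmiris.minor (CannyEmiris.restrictSupp A (CannyEmiris.component Δ φ D))
            (CannyEmiris.component Δ φ D) ρ δ (CannyEmiris.restrictIndex C D δ)) ∧
    CannyEmiris.init ω (CannyEmiris.determinant A Δ ρ δ) =
      ∏ᶠ D ∈ CannyEmiris.mixedCellsOfDim Δ φ n,
        CannyEmiris.determinant (CannyEmiris.restrictSupp A (CannyEmiris.component Δ φ D))
          (CannyEmiris.component Δ φ D) ρ δ := by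
  subst hΔ
  have hφb := fun i => (hφ i).bddBelow (hA i)
  have hfin := CannyEmiris.indexSet_finite hA δ
  have hmain := CannyEmiris.ord_init_minor hn hA hρ htight hδ hφb hφρ ω hω
  refine ⟨hfin, hmain, ?_⟩
  rw [CannyEmiris.determinant, dif_pos hfin, (hmain hfin.toFinset (by simp)).2]
  exact finprod_mem_congr rfl fun D hD =>
    (CannyEmiris.determinant_component hn hA hρ htight hδ hφb hφρ hfin hD.1 _).symm
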